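/- Let $n\ge 0$ and let $f$ be a regular function on $\mathrm{GL}_n(\mathbb C)$, i.e. $f=\det^N p$ with $N\in\mathbb Z$ and $p$ a polynomial in the matrix entries. Notation. The matrix amoeba $\mathrm{s}\mathcal A(f)\subset\mathbb R^n$ is the set of all vectors $(\ln\lambda_1,\dots,\ln\lambda_n)$, where $\lambda_1,\dots,\lambda_n$ are the singular values, in any order, of a matrix $A\in \mathrm{GL}_n(\mathbb C)$ with $f(A)=0$. Write $f(A\,\mathrm{diag}(z)\,B^{-1})=\sum_{m\in\mathbb Z^n}Q_m(A,B)z^m$ for $A,B\in\mathrm{GL}_n(\mathbb C)$, $z\in(\mathbb C^*)^n$; the support of $f$ is the set of $m\in\mathbb Z^n$ such that $Q_m$ is not identically zero, and $\mathrm{sNewt}(f)\subset\mathbb R^n$ is its convex hull. The Ronkin function is $$R_f(x)=\int_{\mathrm U(n)}\int_{\mathrm U(n)}\ln\bigl|f(U\exp(\mathrm{diag}(x))V^*)\bigr|\,d\mu(U)\,d\mu(V),$$ with $\mu$ the Haar probability measure on $\mathrm U(n)$. The order $\nu_f(E)$ of a connected component $E$ of $\mathbb R^n\setminus \mathrm{s}\mathcal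 A(f)$ is $\nabla R_f(x)$ for some $x\in E$. A face of a polytope $\Delta$ is the nonempty set of points of $\Delta$ where some linear form (possibly zero) is maximal on $\Delta$, and the (outer) normal cone of a face $F$ of $\Delta$ is $C_F(\Delta)=\{w\in\mathbb R^n : w\cdot y\le w\cdot x \text{ for all } x\in F,\ y\in\Delta\}$. A cone is a subset of $\mathbb R^n$ stable under multiplication by positive reals. Statement. Let $E$ be a connected component of $\mathbb R^n\setminus \mathrm{s}\mathcal A(f)$. Then $R_f$ is differentiable on $E$ with constant gradient $m=\nu_f(E)$, and $m\in\mathrm{sNewt}(f)\cap\mathbb Z^n$. There is a smallest face $F$ of $\mathrm{sNewt}(f)$ containing $m$, and $C_F=C_F(\mathrm{sNewt}(f))$ is the recession cone $\{w : x+tw\in E \text{ for all } x\in E,\ t\ge 0\}$ of $E$; that is: (a) $x+C_F\subset E$ for every $x\in E$; (b) for every cone $C$ with $C_F\subsetneq C$ and every $x\in\mathbb R^n$, $x+C\not\subset E$. Moreover $E$ is bounded if and only if $m$ is an interior point (in $\mathbb R^n$) of $\mathrm{sNewt}(f)$. -/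

import Mathlib

open MeasureTheory
open scoped MatrixGroups

namespace MatrixAmoeba

/-! ## Regular functions on `GL_n(ℂ)` and their Laurent coefficients -/

/-- `f` is a regular function on `GL_n(ℂ)`: it has the form `det ^ N * p`, with `N` an integer and
`p` a polynomial in the matrix entries. -/
def IsRegularFunction {n : ℕ} (f : GL (Fin n) ℂ → ℂ) : Prop :=
  ∃ (N : ℤ) (p : MvPolynomial (Fin n × Fin n) ℂ), ∀ A : GL (Fin n) ℂ,
    f A = (A : Matrix (Fin n) (Fin n) ℂ).det ^ N *
      MvPolynomial.eval (fun ij : Fin n × Fin n => (A : Matrix (Fin n) (Fin n) ℂ) ij.1 ij.2) p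

/-- The invertible diagonal matrix `diag(z)`, for `z` in the torus `(ℂ*)^n`. -/
noncomputable def diagGL {n : ℕ} (z : Fin n → ℂˣ) : GL (Fin n) ℂ where
  val := Matrix.diagonal fun i => (z i : ℂ)
  inv := Matrix.diagonal fun i => ((z i)⁻¹ : ℂˣ)
  val_inv := by simp [Matrix.diagonal_mul_diagonal]
  inv_val := by simp [Matrix.diagonal_mul_diagonal]

/-- The function `Ψ_{A,B}(f) : z ↦ f (A diag(z) B⁻¹)` on the torus `(ℂ*)^n`. -/
noncomputable def Psi {n : ℕ} (A B : GL (Fin n) ℂ) (f : GL (Fin n) ℂ → ℂ) :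
    (Fin n → ℂˣ) → ℂ :=
  fun z => f (A * diagGL z * B⁻¹)

/-- The function on the torus `(ℂ*)^n` given by the Laurent polynomial `∑ m, c m * z ^ m`. -/
noncomputable def laurentEval {n : ℕ} (c : (Fin n → ℤ) →₀ ℂ) (z : Fin n → ℂˣ) : ℂ :=
  c.sum fun m a => a * ∏ i, (z i : ℂ) ^ m i

open Classical in
/-- The coefficients of a Laurent polynomial function on the torus
(the zero family if `g` is not a Laurent polynomial function). -/
noncomputable def laurentCoeff {n : ℕ} (g : (Fin n → ℂˣ) → ℂ) : (Fin n → ℤ) →₀ ℂ :=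
  if h : ∃ c : (Fin n → ℤ) →₀ ℂ, ∀ z, g z = laurentEval c z then h.choose else 0

/-- The coefficient `Q_m(A, B)` in `f (A diag(z) B⁻¹) = ∑ m, Q_m(A, B) z ^ m`. -/
noncomputable def Q {n : ℕ} (f : GL (Fin n) ℂ → ℂ) (m : Fin n → ℤ) (A B : GL (Fin n) ℂ) : ℂ :=
  laurentCoeff (Psi A B f) m

/-- The support of `f`: the exponents `m` for which `Q_m` is not identically zero. -/
def support {n : ℕ} (f : GL (Fin n) ℂ → ℂ) : Set (Fin n → ℤ) :=
  {m | ∃ A B : GL (Fin n) ℂ, Q f m A B ≠ 0}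

/-- An integer vector, as a point of Euclidean space. -/
noncomputable def intPoint {n : ℕ} (m : Fin n → ℤ) : EuclideanSpace ℝ (Fin n) :=
  WithLp.toLp 2 fun i => (m i : ℝ)

/-- The matrix Newton polytope `sNewt(f)`: the convex hull of the support. -/
noncomputable def sNewt {n : ℕ} (f : GL (Fin n) ℂ → ℂ) : Set (EuclideanSpace ℝ (Fin n)) :=
  convexHull ℝ (intPoint '' support f)

/-! ## The matrix amoeba -/

/-- The logarithms of the singular values of `A`, listed in decreasing order. -/
noncomputable def sLog {n : ℕ} (A : GL (Fin n) ℂ) : EuclideanSpace ℝ (Fin n) :=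
  WithLp.toLp 2 fun i => Real.log
    ((Matrix.toEuclideanLin (A : Matrix (Fin n) (Fin n) ℂ)).singularValues (i : ℕ))

/-- The matrix amoeba of `f`, as a permutation invariant subset of `ℝⁿ`: the vectors of logarithms
of singular values, in any order, of the zeros of `f` in `GL_n(ℂ)`. -/
def amoeba {n : ℕ} (f : GL (Fin n) ℂ → ℂ) : Set (EuclideanSpace ℝ (Fin n)) :=
  {x | ∃ A : GL (Fin n) ℂ, f A = 0 ∧ ∃ σ : Equiv.Perm (Fin n), ∀ i, x i = sLog A (σ i)}

/-- `E` is a connected component of the complement of the matrix amoeba of `f`. -/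
def IsComplementComponent {n : ℕ} (f : GL (Fin n) ℂ → ℂ)
    (E : Set (EuclideanSpace ℝ (Fin n))) : Prop :=
  ∃ x ∈ (amoeba f)ᶜ, E = connectedComponentIn (amoeba f)ᶜ x

/-! ## The Haar measure on `U(n)`, the Ronkin function and the order -/

instance unitaryCompactSpace (n : ℕ) : CompactSpace (Matrix.unitaryGroup (Fin n) ℂ) := by
  refine (isCompact_iff_compactSpace
    (s := (Matrix.unitaryGroup (Fin n) ℂ : Set (Matrix (Fin n) (Fin n) ℂ)))).mp ?_
  have hsub : ((Matrix.unitaryGroup (Fin n) ℂ : Set (Matrix (Fin n) (Fin n) ℂ))) ⊆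
      Set.univ.pi fun _ => Set.univ.pi fun _ => Metric.closedBall (0 : ℂ) 1 := by
    intro U hU i _ j _
    simpa using entry_norm_bound_of_unitary hU i j
  have hclosed : IsClosed (Matrix.unitaryGroup (Fin n) ℂ : Set (Matrix (Fin n) (Fin n) ℂ)) :=
    isClosed_unitary (R := Matrix (Fin n) (Fin n) ℂ)
  have hbox : IsCompact (Set.univ.pi fun _ => Set.univ.pi fun _ => Metric.closedBall 0 1 :
      Set (Matrix (Fin n) (Fin n) ℂ)) :=
    isCompact_univ_pi fun _ => isCompact_univ_pi fun _ => isCompact_closedBall _ _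
  exact hbox.of_isClosed_subset hclosed hsub

noncomputable instance unitaryMeasurableSpace (n : ℕ) : MeasurableSpace (Matrix.unitaryGroup (Fin n) ℂ) :=
  borel _

instance unitaryBorelSpace (n : ℕ) : BorelSpace (Matrix.unitaryGroup (Fin n) ℂ) := ⟨rfl⟩

/-- The Haar probability measure on the compact group `U(n)`. -/
noncomputable def haarU (n : ℕ) : Measure (Matrix.unitaryGroup (Fin n) ℂ) :=
  Measure.haarMeasure ⊤

/-- A unitary matrix as an element of `GL_n(ℂ)`. -/
noncomputable def unitaryToGL {n : ℕ} (U : Matrix.unitaryGroup (Fin n) ℂ) : GL (Fin n) ℂ :=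
  Unitary.toUnits U

/-- The diagonal matrix `exp(diag(x))`, for a real vector `x`. -/
noncomputable def expDiag {n : ℕ} (x : EuclideanSpace ℝ (Fin n)) : GL (Fin n) ℂ :=
  diagGL fun i => Units.mk0 (Complex.exp (x i)) (Complex.exp_ne_zero _)

/-- The Ronkin function `R_f(x) = ∫∫ log |f (U exp(diag(x)) V^*)| dμ(U) dμ(V)`. Where the integral
is `-∞` the value here is a junk value; off the amoeba the integrand is continuous in `(U, V)`, and
only there is `R_f` used, through its gradient. -/
noncomputable def ronkin {n : ℕ} (f : GL (Fin n) ℂ → ℂ) (x : EuclideanSpace ℝ (Fin n)) : ℝ :=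
  ∫ V, ∫ U, Real.log ‖f (unitaryToGL U * expDiag x * unitaryToGL (star V))‖ ∂(haarU n) ∂(haarU n)

open Classical in
/-- The order `ν_f(E)` of a component `E`: the gradient `∇ R_f(x)` at some point `x` of `E`
(zero if `E` is empty). -/
noncomputable def order {n : ℕ} (f : GL (Fin n) ℂ → ℂ) (E : Set (EuclideanSpace ℝ (Fin n))) :
    EuclideanSpace ℝ (Fin n) :=
  if h : E.Nonempty then gradient (ronkin f) h.some else 0

/-! ## Convex geometry -/

/-- `F` is a (nonempty) face of the polytope `P`: the set of points of `P` at which some linear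
form attains its maximum on `P`; the zero form gives `P` itself. -/
def IsFace {n : ℕ} (P F : Set (EuclideanSpace ℝ (Fin n))) : Prop :=
  F.Nonempty ∧ IsExposed ℝ P F

/-- The outer normal cone of `P` along `F`: the directions `w` for which `⟪w, ·⟫` attains its
maximum over `P` at every point of `F`. -/
def normalCone {n : ℕ} (P F : Set (EuclideanSpace ℝ (Fin n))) : Set (EuclideanSpace ℝ (Fin n)) :=
  {w | ∀ x ∈ F, ∀ y ∈ P, inner ℝ w y ≤ inner ℝ w x}

/-- The recession cone of `E`: the directions `w` such that every ray issued from a point of `E` in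
the direction `w` stays in `E`. -/
def recessionCone {n : ℕ} (E : Set (EuclideanSpace ℝ (Fin n))) :
    Set (EuclideanSpace ℝ (Fin n)) :=
  {w | ∀ x ∈ E, ∀ t : ℝ, 0 ≤ t → x + t • w ∈ E}

/-- A cone: a set stable under multiplication by positive scalars. -/
def IsCone {n : ℕ} (C : Set (EuclideanSpace ℝ (Fin n))) : Prop :=
  ∀ w ∈ C, ∀ t : ℝ, 0 < t → t • w ∈ C

end MatrixAmoeba

/-!
By the singular value decomposition, a point `x` lies in the matrix amoeba of `f` if and only if
`f (U exp(diag(x)) V*) = 0` for some unitary `U`, `V` (`mem_amoeba_iff`). Hence the complement of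
the amoeba is the set of points off the amoebas of all members of the family of Laurent
polynomials `g_{U,V}(z) = f (U diag(z) V*)`, parametrised by the compact connected group
`U(n) × U(n)`. The torus acts on the parameters by `(U, V) ↦ (U exp(i diag(θ)), V)`, which amounts to a
rotation of `z`. All arguments about components take place for such a family (`LaurentFamily`).

For an integral direction `v` and a point `x` off the amoeba, the loop `τ ↦ g(exp(x + i τ v))` has
a winding number around `0`. It is an integer depending continuously on `x`, `U`, `V`, so it is
constant on a component `E` (`LaurentFamily.exists_winding_eq`). It is the circle average of a
logarithmic derivative; as the torus action preserves the Haar measure, its mean over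
`U(n) × U(n)` is the derivative of the Ronkin function in the direction `v`. So the gradient of the Ronkin
function is on `E` an integer vector `m`, and the winding number along `v` is `m · v`
(`LaurentFamily.exists_gradient_eq_winding`).

By the argument principle, `m · v` is, up to a shift, the number of roots in the unit disk of the
one-variable polynomial `s ↦ g(exp(x) s ^ v)`. This yields the geometric statements.
* The number of roots is at most the degree, so `m · v` is at most the maximum of `a · v` over the
  support, and `m` lies in the Newton polytope.
* If `v` is maximal on the polytope at `m`, all roots lie in the unit disk, and hence the ray from
  `x` in the direction `v` avoids the amoeba. A real direction `w` reduces to integral ones: it is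
  approximated by rational vectors that satisfy all its integral linear relations
  (`exists_int_direction_near`).
* If points of `E` escape to infinity in the direction `w`, then at such points, and for suitable
  parameters, the terms of `g` on the face exposed by `w` dominate all others. Along rational
  directions near `w` all roots then lie in the unit disk, and the winding number is the degree.
  In the limit `w` is maximal on the polytope at `m`
  (`LaurentFamily.IsOrder.inner_le_of_tendsto`). This bounds the recession cone from above, and
  gives an element of the normal cone at `m` when `E` is unbounded.

The dominating exponents come from the support of `f`, which is defined through all invertible
matrices; they occur for unitary matrices as well because `U(n)` is Zariski dense in `GL_n`
(`eval_eq_zero_of_unitary`).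
-/

namespace MatrixAmoeba

/-! ### Rational directions and faces of lattice polytopes -/

theorem inner_intPoint {n : ℕ} (a : Fin n → ℤ) (x : EuclideanSpace ℝ (Fin n)) :
    inner ℝ (intPoint a) x = ∑ i, (a i : ℝ) * x i := by
  simp [intPoint, PiLp.inner_apply, mul_comm]

theorem inner_intPoint_intPoint {n : ℕ} (a v : Fin n → ℤ) :
    inner ℝ (intPoint a) (intPoint v) = ((a ⬝ᵥ v : ℤ) : ℝ) := by
  rw [inner_intPoint]
  simp [intPoint, dotProduct]

/-- Every real vector `w` is a limit of rational vectors that satisfy all the integral linear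
relations satisfied by `w`: the coordinates of `w` span a finite dimensional `ℚ`-vector space, and
one may replace a `ℚ`-basis of it by nearby rational numbers. -/
theorem exists_int_direction_near {n : ℕ} (w : EuclideanSpace ℝ (Fin n))
    {U : Set (EuclideanSpace ℝ (Fin n))} (hU : U ∈ nhds w) :
    ∃ (v : Fin n → ℤ) (N : ℕ), 0 < N ∧ (N : ℝ)⁻¹ • intPoint v ∈ U ∧
      ∀ d : Fin n → ℤ, inner ℝ (intPoint d) w = 0 → d ⬝ᵥ v = 0 := by
  let M : Submodule ℚ ℝ := Submodule.span ℚ (Set.range fun i => w i)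
  have : Module.Finite ℚ M := FiniteDimensional.span_of_finite ℚ (Set.finite_range _)
  let β := Module.finBasis ℚ M
  let c : Fin n → Fin (Module.finrank ℚ M) → ℚ := fun i =>
    β.repr ⟨w i, Submodule.subset_span ⟨i, rfl⟩⟩
  have hw (i : Fin n) : w i = ∑ j, (c i j : ℝ) * (β j : ℝ) := by
    have h := congrArg (Subtype.val) (β.sum_repr ⟨w i, Submodule.subset_span ⟨i, rfl⟩⟩)
    simp only [Submodule.coe_sum, Submodule.coe_smul, Rat.smul_def] at h
    exact h.symm
  let Φ : (Fin (Module.finrank ℚ M) → ℝ) → EuclideanSpace ℝ (Fin n) := fun r =>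
    WithLp.toLp 2 fun i => ∑ j, (c i j : ℝ) * r j
  have hΦ : Continuous Φ := by
    refine (PiLp.continuous_toLp 2 _).comp ?_
    fun_prop
  have hΦβ : Φ (fun j => (β j : ℝ)) = w := by
    ext i
    exact (hw i).symm
  have hdense : DenseRange (fun (q : Fin (Module.finrank ℚ M) → ℚ) j => (q j : ℝ)) :=
    DenseRange.piMap fun _ => Rat.denseRange_cast
  obtain ⟨q, hq⟩ := hdense.exists_mem_open (isOpen_interior.preimage hΦ)
    ⟨fun j => (β j : ℝ), by simpa [hΦβ] using mem_interior_iff_mem_nhds.2 hU⟩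
  let u : Fin n → ℚ := fun i => ∑ j, c i j * q j
  let N : ℕ := ∏ i, (u i).den
  have hN : 0 < N := Finset.prod_pos fun i _ => (u i).den_pos
  have hv (i : Fin n) : ∃ z : ℤ, (z : ℚ) = N * u i := by
    refine ⟨(∏ j ∈ Finset.univ.erase i, ((u j).den : ℤ)) * (u i).num, ?_⟩
    have h1 : (N : ℚ) = (∏ j ∈ Finset.univ.erase i, ((u j).den : ℚ)) * (u i).den := by
      simp only [N, Nat.cast_prod]
      exact (Finset.prod_erase_mul _ _ (Finset.mem_univ i)).symm
    rw [h1, mul_assoc, mul_comm ((u i).den : ℚ) (u i), Rat.mul_den_eq_num]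
    push_cast
    rfl
  choose v hv using hv
  -- An integral relation for `w` holds for each coordinate with respect to `β`, hence for `v`.
  refine ⟨v, N, hN, ?_, fun d hd => ?_⟩
  · have h : (N : ℝ)⁻¹ • intPoint v = Φ fun j => (q j : ℝ) := by
      ext i
      have h2 : (v i : ℝ) = N * u i := by exact_mod_cast congrArg (Rat.cast (K := ℝ)) (hv i)
      have h3 : (N : ℝ) ≠ 0 := by positivity
      simp only [intPoint, PiLp.smul_apply, smul_eq_mul, h2, Φ, u]
      rw [inv_mul_cancel_left₀ h3]
      push_cast
      rfl
    rw [h]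
    exact interior_subset hq
  · have h1 : ∑ j, (∑ i, (d i : ℚ) * c i j) • β j = 0 := by
      apply Subtype.ext
      simp only [Submodule.coe_sum, Submodule.coe_smul, Rat.smul_def, Submodule.coe_zero]
      rw [inner_intPoint] at hd
      simp_rw [hw, Finset.mul_sum] at hd
      rw [Finset.sum_comm] at hd
      rw [← hd]
      refine Finset.sum_congr rfl fun j _ => ?_
      push_cast
      rw [Finset.sum_mul]
      exact Finset.sum_congr rfl fun i _ => by ring
    have h2 := fun j => Fintype.linearIndependent_iff.1 β.linearIndependent _ h1 j
    have h3 : (((d ⬝ᵥ v : ℤ)) : ℚ) = 0 := by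
      simp only [dotProduct, Int.cast_sum, Int.cast_mul, hv, u, Finset.mul_sum]
      rw [Finset.sum_comm]
      refine Finset.sum_eq_zero fun j _ => ?_
      have := congrArg (fun r => (N : ℚ) * q j * r) (h2 j)
      simp only [Finset.mul_sum, mul_zero] at this
      rw [← this]
      exact Finset.sum_congr rfl fun i _ => by ring
    exact_mod_cast h3

/-- A linear form is bounded on a convex hull by a bound for its values on the generators. -/
theorem inner_le_of_mem_convexHull {n : ℕ} {A : Set (Fin n → ℤ)} {w y : EuclideanSpace ℝ (Fin n)}
    {c : ℝ} (h : ∀ a ∈ A, inner ℝ (intPoint a) w ≤ c) (hy : y ∈ convexHull ℝ (intPoint '' A)) :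
    inner ℝ w y ≤ c := by
  have hc : Convex ℝ {y : EuclideanSpace ℝ (Fin n) | inner ℝ w y ≤ c} :=
    convex_halfSpace_le (innerSL ℝ w).isLinear c
  refine convexHull_min ?_ hc hy
  rintro _ ⟨a, ha, rfl⟩
  simpa [real_inner_comm] using h a ha

theorem mem_normalCone_singleton_iff {n : ℕ} {A : Set (Fin n → ℤ)}
    {w p : EuclideanSpace ℝ (Fin n)} :
    w ∈ normalCone (convexHull ℝ (intPoint '' A)) {p} ↔
      ∀ a ∈ A, inner ℝ (intPoint a) w ≤ inner ℝ p w := by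
  constructor
  · intro h a ha
    have := h p rfl (intPoint a) (subset_convexHull ℝ _ ⟨a, ha, rfl⟩)
    rwa [real_inner_comm, real_inner_comm p] at this
  · rintro h x rfl y hy
    rw [real_inner_comm x w]
    exact inner_le_of_mem_convexHull h hy

/-- The smallest face of a polytope `P` containing a point `p` is the one exposed by a vector in the
relative interior of the cone of all linear forms that are maximal at `p`. -/
theorem exists_isLeast_face {n : ℕ} {A : Set (Fin n → ℤ)} (hA : A.Finite)
    {p : EuclideanSpace ℝ (Fin n)} (hp : p ∈ convexHull ℝ (intPoint '' A)) :
    ∃ F, IsLeast {G | IsFace (convexHull ℝ (intPoint '' A)) G ∧ p ∈ G} F ∧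
      normalCone (convexHull ℝ (intPoint '' A)) F =
        normalCone (convexHull ℝ (intPoint '' A)) {p} := by
  set P := convexHull ℝ (intPoint '' A) with hP
  have hAP {a : Fin n → ℤ} (ha : a ∈ A) : intPoint a ∈ P := subset_convexHull ℝ _ ⟨a, ha, rfl⟩
  -- For each generator lying off some face through `p`, a form maximal at `p` but not there.
  have key (a : Fin n → ℤ) : ∃ w ∈ normalCone P {p},
      (∃ w' ∈ normalCone P {p}, inner ℝ w' (intPoint a) < inner ℝ w' p) →
        inner ℝ w (intPoint a) < inner ℝ w p := by
    by_cases h : ∃ w' ∈ normalCone P {p}, inner ℝ w' (intPoint a) < inner ℝ w' p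
    · obtain ⟨w', h1, h2⟩ := h
      exact ⟨w', h1, fun _ => h2⟩
    · exact ⟨0, fun x _ y _ => by simp, fun h' => absurd h' h⟩
  choose ω hω1 hω2 using key
  let w₀ : EuclideanSpace ℝ (Fin n) := ∑ a ∈ hA.toFinset, ω a
  have hle (a : Fin n → ℤ) {y} (hy : y ∈ P) : inner ℝ (ω a) y ≤ inner ℝ (ω a) p :=
    hω1 a p rfl y hy
  have hw₀ {y} (hy : y ∈ P) : inner ℝ w₀ y ≤ inner ℝ w₀ p := by
    simp only [w₀, sum_inner]
    exact Finset.sum_le_sum fun a _ => hle a hy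
  have hmax {y} (hy : y ∈ P) (hyp : inner ℝ w₀ y = inner ℝ w₀ p) {w} (hw : w ∈ normalCone P {p}) :
      inner ℝ w y = inner ℝ w p := by
    refine le_antisymm (hw p rfl y hy) ?_
    -- A large multiple of `w₀` minus `w` still attains its maximum on `P` at `p`.
    have hT : ∃ T : ℝ, ∀ a ∈ A,
        inner ℝ (intPoint a) (T • w₀ - w) ≤ inner ℝ p (T • w₀ - w) := by
      have hev : ∀ᶠ T : ℝ in Filter.atTop, ∀ a ∈ A,
          inner ℝ (intPoint a) (T • w₀ - w) ≤ inner ℝ p (T • w₀ - w) := by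
        rw [Filter.eventually_all_finite hA]
        intro a ha
        simp only [inner_sub_right, inner_smul_right]
        by_cases h : inner ℝ w (intPoint a) = inner ℝ w p
        · filter_upwards [Filter.eventually_ge_atTop 0] with T hT
          have := hw₀ (hAP ha)
          rw [real_inner_comm, real_inner_comm p] at this
          rw [real_inner_comm w, real_inner_comm w, h]
          nlinarith
        · have h' := lt_of_le_of_ne (hw p rfl _ (hAP ha)) h
          have hlt : inner ℝ w₀ (intPoint a) < inner ℝ w₀ p := by
            simp only [w₀, sum_inner]
            exact Finset.sum_lt_sum (fun b _ => hle b (hAP ha))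
              ⟨a, hA.mem_toFinset.2 ha, hω2 a ⟨w, hw, h'⟩⟩
          rw [real_inner_comm, real_inner_comm p] at hlt
          filter_upwards [Filter.eventually_ge_atTop
            ((inner ℝ p w - inner ℝ (intPoint a) w) / (inner ℝ p w₀ - inner ℝ (intPoint a) w₀))]
            with T hT
          rw [div_le_iff₀ (by linarith)] at hT
          linarith
      exact hev.exists
    obtain ⟨T, hT⟩ := hT
    have h1 := inner_le_of_mem_convexHull hT hy
    rw [real_inner_comm _ p] at h1
    simp only [inner_sub_left, real_inner_smul_left, hyp] at h1
    linarith
  have hface : IsFace P {y ∈ P | ∀ z ∈ P, innerSL ℝ w₀ z ≤ innerSL ℝ w₀ y} :=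
    ⟨⟨p, hp, fun z hz => hw₀ hz⟩, fun _ => ⟨innerSL ℝ w₀, rfl⟩⟩
  have hF {y} (hy : y ∈ P) (hy' : ∀ z ∈ P, innerSL ℝ w₀ z ≤ innerSL ℝ w₀ y) :
      inner ℝ w₀ y = inner ℝ w₀ p :=
    le_antisymm (hw₀ hy) (hy' p hp)
  refine ⟨_, ⟨⟨hface, hp, fun z hz => hw₀ hz⟩, ?_⟩, ?_⟩
  · rintro G ⟨⟨hne, hG⟩, hpG⟩ y ⟨hy, hy'⟩
    obtain ⟨l, rfl⟩ := hG hne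
    let w := (InnerProductSpace.toDual ℝ (EuclideanSpace ℝ (Fin n))).symm l
    have hwl (z : EuclideanSpace ℝ (Fin n)) : inner ℝ w z = l z :=
      InnerProductSpace.toDual_symm_apply (𝕜 := ℝ)
    have hw : w ∈ normalCone P {p} := by
      rintro x rfl z hz
      rw [hwl, hwl]
      exact hpG.2 z hz
    have := hmax hy (hF hy hy') hw
    rw [hwl, hwl] at this
    exact ⟨hy, fun z hz => this ▸ hpG.2 z hz⟩
  · ext w
    constructor
    · rintro h x rfl y hy
      exact h x ⟨hp, fun z hz => hw₀ hz⟩ y hy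
    · rintro h x ⟨hx, hx'⟩ y hy
      rw [hmax hx (hF hx hx') h]
      exact h p rfl y hy

/-- An integer point lies in a lattice polytope as soon as no *integral* linear form separates it
from the polytope. -/
theorem intPoint_mem_convexHull {n : ℕ} {A : Set (Fin n → ℤ)} (hA : A.Finite) {m : Fin n → ℤ}
    (h : ∀ v : Fin n → ℤ, ∃ a ∈ A, m ⬝ᵥ v ≤ a ⬝ᵥ v) :
    intPoint m ∈ convexHull ℝ (intPoint '' A) := by
  by_contra hm
  obtain ⟨l, u, h1, h2⟩ := geometric_hahn_banach_closed_point (convex_convexHull ℝ _)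
    ((hA.image _).isClosed_convexHull ℝ) hm
  let w := (InnerProductSpace.toDual ℝ (EuclideanSpace ℝ (Fin n))).symm l
  have hwl (z : EuclideanSpace ℝ (Fin n)) : inner ℝ z w = l z := by
    rw [real_inner_comm]
    exact InnerProductSpace.toDual_symm_apply (𝕜 := ℝ)
  have hU : {w' : EuclideanSpace ℝ (Fin n) |
      ∀ a ∈ A, inner ℝ (intPoint a) w' < inner ℝ (intPoint m) w'} ∈ nhds w := by
    change ∀ᶠ w' in nhds w, ∀ a ∈ A, inner ℝ (intPoint a) w' < inner ℝ (intPoint m) w'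
    rw [Filter.eventually_all_finite hA]
    intro a ha
    refine (ContinuousAt.eventually_lt (by fun_prop) (by fun_prop) ?_)
    rw [hwl, hwl]
    exact (h1 _ (subset_convexHull ℝ _ ⟨a, ha, rfl⟩)).trans h2
  obtain ⟨v, N, hN, hv, -⟩ := exists_int_direction_near w hU
  obtain ⟨a, ha, hle⟩ := h v
  have := hv a ha
  rw [inner_smul_right, inner_smul_right, inner_intPoint_intPoint, inner_intPoint_intPoint,
    mul_lt_mul_iff_right₀ (by positivity)] at this
  exact absurd hle (not_le.2 (by exact_mod_cast this))

/-- A point of a polytope is interior exactly when no nonzero linear form is maximal at it. -/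
theorem mem_interior_convexHull_iff {n : ℕ} {A : Set (Fin n → ℤ)} (hA : A.Finite)
    (hne : A.Nonempty) {p : EuclideanSpace ℝ (Fin n)} :
    p ∈ interior (convexHull ℝ (intPoint '' A)) ↔
      ∀ w ∈ normalCone (convexHull ℝ (intPoint '' A)) {p}, w = 0 := by
  set P := convexHull ℝ (intPoint '' A) with hP
  constructor
  · intro hp w hw
    have h1 : Filter.Tendsto (fun t : ℝ => p + t • w) (nhds 0) (nhds p) := by
      have : Continuous fun t : ℝ => p + t • w := by fun_prop
      simpa using this.tendsto 0
    have h2 := (h1.eventually (mem_interior_iff_mem_nhds.1 hp)).filter_mono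
      (nhdsWithin_le_nhds (s := Set.Ioi 0))
    obtain ⟨t, ht, ht0⟩ := (h2.and self_mem_nhdsWithin).exists
    have h3 := hw p rfl _ ht
    rw [inner_add_right, inner_smul_right, real_inner_self_eq_norm_sq] at h3
    have h4 : ‖w‖ ^ 2 ≤ 0 := by
      have : (0 : ℝ) < t := ht0
      nlinarith
    simpa using le_antisymm h4 (sq_nonneg _)
  · intro h
    by_contra hp
    -- Otherwise `p` is a limit of points off `P`; the limit of forms separating these from `P`
    -- supports `P` at `p`.
    rw [← Set.mem_compl_iff, ← closure_compl, mem_closure_iff_seq_limit] at hp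
    obtain ⟨y, hy, hlim⟩ := hp
    have hsep (k : ℕ) : ∃ w ∈ Metric.sphere (0 : EuclideanSpace ℝ (Fin n)) 1,
        ∀ z ∈ P, inner ℝ w z ≤ inner ℝ w (y k) := by
      obtain ⟨l, u, h1, h2⟩ := geometric_hahn_banach_closed_point (convex_convexHull ℝ _)
        ((hA.image _).isClosed_convexHull ℝ) (hy k)
      let w := (InnerProductSpace.toDual ℝ (EuclideanSpace ℝ (Fin n))).symm l
      have hwl (z : EuclideanSpace ℝ (Fin n)) : inner ℝ w z = l z :=
        InnerProductSpace.toDual_symm_apply (𝕜 := ℝ)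
      have hw : w ≠ 0 := by
        obtain ⟨z, hz⟩ : P.Nonempty := (hne.image _).mono (subset_convexHull ℝ _)
        intro h0
        have h3 := (h1 z hz).trans h2
        rw [← hwl, ← hwl, h0] at h3
        simp at h3
      refine ⟨‖w‖⁻¹ • w, by simp [norm_smul, hw], fun z hz => ?_⟩
      rw [real_inner_smul_left, real_inner_smul_left, hwl, hwl]
      exact mul_le_mul_of_nonneg_left ((h1 z hz).trans h2).le (by positivity)
    choose w hw1 hw2 using hsep
    obtain ⟨w', hw', φ, hφ, hlim'⟩ := (isCompact_sphere _ _).tendsto_subseq hw1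
    have h0 := h w' (by
      rintro x rfl z hz
      refine le_of_tendsto_of_tendsto (hlim'.inner tendsto_const_nhds)
        (hlim'.inner (hlim.comp hφ.tendsto_atTop)) (Filter.Eventually.of_forall fun k => ?_)
      exact hw2 _ z hz)
    rw [h0] at hw'
    simp at hw'

/-! ### Counting the roots of a polynomial in the unit disk -/

theorem circleIntegral_sum_inv_sub (R : Multiset ℂ) (hR : ∀ r ∈ R, ‖r‖ ≠ 1) :
    CircleIntegrable (fun z => (R.map fun r => 1 / (z - r)).sum) 0 1 ∧
    (∮ z in C(0, 1), (R.map fun r => 1 / (z - r)).sum) =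
      2 * Real.pi * Complex.I * (R.filter fun r => ‖r‖ < 1).card := by
  induction R using Multiset.induction_on with
  | empty => simp [CircleIntegrable, circleIntegral]
  | cons r R ih =>
    have hr := hR r (Multiset.mem_cons_self r R)
    obtain ⟨ih1, ih2⟩ := ih fun s hs => hR s (Multiset.mem_cons_of_mem hs)
    have hi : CircleIntegrable (fun z => 1 / (z - r)) 0 1 := by
      simp_rw [one_div]
      rw [circleIntegrable_sub_inv_iff]
      right
      simpa using hr
    simp only [Multiset.map_cons, Multiset.sum_cons]
    refine ⟨hi.add ih1, ?_⟩
    rw [circleIntegral.integral_add hi ih1, ih2]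
    simp_rw [one_div]
    rcases lt_or_gt_of_ne hr with h | h
    · rw [circleIntegral.integral_sub_inv_of_mem_ball (by simpa using h),
        Multiset.filter_cons_of_pos (p := fun r : ℂ => ‖r‖ < 1) _ h, Multiset.card_cons]
      push_cast
      ring
    · have h0 : (∮ z in C(0, 1), (z - r)⁻¹) = 0 := by
        have hne (z : ℂ) (hz : z ∈ Metric.closedBall (0 : ℂ) 1) : z - r ≠ 0 := by
          rw [sub_ne_zero]
          rintro rfl
          simp at hz
          linarith
        refine Complex.circleIntegral_eq_zero_of_differentiable_on_off_countable zero_le_one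
          Set.countable_empty (fun z hz => ?_) fun z hz => ?_
        · exact ((continuousAt_id.sub continuousAt_const).inv₀ (hne z hz)).continuousWithinAt
        · exact (differentiableAt_id.sub_const r).inv (hne z (Metric.ball_subset_closedBall hz.1))
      rw [h0, Multiset.filter_cons_of_neg (p := fun r : ℂ => ‖r‖ < 1) _ h.not_gt, zero_add]

/-- The argument principle for a polynomial on the unit circle. -/
theorem circleAverage_mul_derivative_div (p : Polynomial ℂ) (hp : ∀ s, ‖s‖ = 1 → p.eval s ≠ 0) :
    Real.circleAverage (fun s => s * (p.derivative.eval s / p.eval s)) 0 1 =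
      (p.roots.filter fun r => ‖r‖ < 1).card := by
  rw [Real.circleAverage_eq_circleIntegral one_ne_zero]
  have h : (∮ z in C(0, 1), (z - 0)⁻¹ • (z * (p.derivative.eval z / p.eval z))) =
      ∮ z in C(0, 1), (p.roots.map fun r => 1 / (z - r)).sum := by
    refine circleIntegral.integral_congr zero_le_one fun z hz => ?_
    have hz1 : ‖z‖ = 1 := by simpa using hz
    have hz0 : z ≠ 0 := by
      rintro rfl
      simp at hz1
    simp only [sub_zero, smul_eq_mul, inv_mul_cancel_left₀ hz0]
    exact (IsAlgClosed.splits p).eval_derivative_div_eval_of_ne_zero (hp z hz1)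
  rw [h, (circleIntegral_sum_inv_sub _ _).2, smul_eq_mul,
    inv_mul_cancel_left₀ Complex.two_pi_I_ne_zero]
  intro r hr h1
  exact hp r h1 (Polynomial.isRoot_of_mem_roots hr)

theorem card_roots_filter_le (p : Polynomial ℂ) :
    (p.roots.filter fun r => ‖r‖ < 1).card ≤ p.natDegree :=
  (Multiset.card_le_card (Multiset.filter_le _ _)).trans p.card_roots'

/-- If the open unit disk contains as many roots as the degree allows, there is no other root. -/
theorem eval_ne_zero_of_natDegree_le_card {p : Polynomial ℂ} (hp : p ≠ 0)
    (h : p.natDegree ≤ (p.roots.filter fun r => ‖r‖ < 1).card) {s : ℂ} (hs : 1 ≤ ‖s‖) :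
    p.eval s ≠ 0 := by
  intro h0
  have h1 : p.roots.filter (fun r => ‖r‖ < 1) = p.roots :=
    Multiset.eq_of_le_of_card_le (Multiset.filter_le _ _) (p.card_roots'.trans h)
  have h2 : s ∈ p.roots := (Polynomial.mem_roots hp).2 h0
  rw [← h1, Multiset.mem_filter] at h2
  exact absurd hs (not_le.2 h2.2)

theorem card_roots_filter_eq_natDegree {p : Polynomial ℂ}
    (h : ∀ s, 1 ≤ ‖s‖ → p.eval s ≠ 0) :
    (p.roots.filter fun r => ‖r‖ < 1).card = p.natDegree := by
  rw [Multiset.filter_eq_self.2, ← (IsAlgClosed.splits p).natDegree_eq_card_roots]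
  intro r hr
  by_contra hr1
  exact h r (not_lt.1 hr1) (Polynomial.isRoot_of_mem_roots hr)

/-- If the top degree part of a polynomial dominates the other coefficients, then all its roots lie
in the open unit disk. -/
theorem card_roots_filter_eq_of_dominant {ι : Type*} (S : Finset ι) (b : ι → ℂ) (e : ι → ℕ) (H : ℕ)
    (he : ∀ a ∈ S, e a ≤ H)
    (hdom : ∑ a ∈ S with e a ≠ H, ‖b a‖ < ‖∑ a ∈ S with e a = H, b a‖) :
    ((∑ a ∈ S, Polynomial.monomial (e a) (b a)).roots.filter fun r => ‖r‖ < 1).card = H := by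
  set p := ∑ a ∈ S, Polynomial.monomial (e a) (b a) with hp
  have hdeg : p.natDegree = H := by
    refine Polynomial.natDegree_eq_of_le_of_coeff_ne_zero ?_ ?_
    · exact Polynomial.natDegree_sum_le_of_forall_le _ _ fun a ha =>
        (Polynomial.natDegree_monomial_le _).trans (he a ha)
    · simp only [hp, Polynomial.finsetSum_coeff, Polynomial.coeff_monomial]
      rw [← Finset.sum_filter]
      intro h0
      rw [h0, norm_zero] at hdom
      exact absurd hdom (not_lt.2 (Finset.sum_nonneg fun _ _ => norm_nonneg _))
  rw [card_roots_filter_eq_natDegree, hdeg]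
  intro s hs h0
  have hs0 : 0 < ‖s‖ := one_pos.trans_le hs
  have h1 : p.eval s = (∑ a ∈ S with e a = H, b a) * s ^ H +
      ∑ a ∈ S with e a ≠ H, b a * s ^ e a := by
    simp only [hp, Polynomial.eval_finsetSum, Polynomial.eval_monomial]
    rw [← Finset.sum_filter_add_sum_filter_not S (fun a => e a = H), Finset.sum_mul]
    congr 1
    refine Finset.sum_congr rfl fun a ha => ?_
    rw [(Finset.mem_filter.1 ha).2]
  rw [h1, add_eq_zero_iff_eq_neg] at h0
  have h2 := congrArg norm h0
  rw [norm_neg, norm_mul, norm_pow] at h2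
  have h3 : ‖∑ a ∈ S with e a ≠ H, b a * s ^ e a‖ ≤
      (∑ a ∈ S with e a ≠ H, ‖b a‖) * ‖s‖ ^ H := by
    rw [Finset.sum_mul]
    refine norm_sum_le_of_le _ fun a ha => ?_
    rw [norm_mul, norm_pow]
    gcongr
    exact he a (Finset.mem_filter.1 ha).1
  rw [← h2] at h3
  exact absurd (le_of_mul_le_mul_right h3 (by positivity)) (not_le.2 hdom)

/-! ### Families of Laurent polynomials and winding numbers -/

/-- A family of Laurent polynomials `z ↦ ∑ a, q a k * z ^ a` in `n` variables, parametrised by the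
points `k` of a topological space `K`. The compact torus of angle vectors `θ` acts on `K`, and this
action corresponds to the rotation `z ↦ exp (i θ) z` of the variables. -/
structure LaurentFamily (n : ℕ) (K : Type*) [TopologicalSpace K] where
  /-- The finite set of exponents that occur in some member of the family. -/
  S : Finset (Fin n → ℤ)
  /-- The coefficients. -/
  q : (Fin n → ℤ) → K → ℂ
  continuous_q : ∀ a, Continuous (q a)
  exists_q_ne_zero : ∀ a ∈ S, ∃ k, q a k ≠ 0
  /-- The action of angle vectors on the parameter space. -/
  act : EuclideanSpace ℝ (Fin n) → K → K
  q_act : ∀ a θ k, q a (act θ k) = q a k * Complex.exp ((inner ℝ (intPoint a) θ : ℝ) * Complex.I)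

namespace LaurentFamily

variable {n : ℕ} {K : Type*} [TopologicalSpace K] (L : LaurentFamily n K)

/-- The monomial of exponent `a` at the positive real point `exp x`. -/
noncomputable def term (a : Fin n → ℤ) (x : EuclideanSpace ℝ (Fin n)) (k : K) : ℂ :=
  L.q a k * Complex.exp (inner ℝ (intPoint a) x : ℝ)

/-- The value of the Laurent polynomial with parameter `k` at the positive real point `exp x`. -/
noncomputable def eval (x : EuclideanSpace ℝ (Fin n)) (k : K) : ℂ := ∑ a ∈ L.S, L.term a x k

/-- The derivative of `x ↦ L.eval x k` in the direction `u`. -/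
noncomputable def dirDeriv (u x : EuclideanSpace ℝ (Fin n)) (k : K) : ℂ :=
  ∑ a ∈ L.S, (inner ℝ (intPoint a) u : ℝ) * L.term a x k

/-- The complement of the union of the amoebas of the members of the family. -/
def amoebaCompl : Set (EuclideanSpace ℝ (Fin n)) := {x | ∀ k, L.eval x k ≠ 0}

/-- The winding number around `0` of the loop `τ ↦ L.eval x (L.act (τ v) k)`, for an integral
direction `v`, written as an average of the logarithmic derivative. -/
noncomputable def winding (v : Fin n → ℤ) (x : EuclideanSpace ℝ (Fin n)) (k : K) : ℂ :=
  ((2 * Real.pi : ℝ) : ℂ)⁻¹ * ∫ τ in (0 : ℝ)..(2 * Real.pi),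
    L.dirDeriv (intPoint v) x (L.act (τ • intPoint v) k) / L.eval x (L.act (τ • intPoint v) k)

theorem term_act (a : Fin n → ℤ) (x θ : EuclideanSpace ℝ (Fin n)) (k : K) :
    L.term a x (L.act θ k) =
      L.term a x k * Complex.exp ((inner ℝ (intPoint a) θ : ℝ) * Complex.I) := by
  rw [term, term, q_act]
  ring

theorem term_add (a : Fin n → ℤ) (x y : EuclideanSpace ℝ (Fin n)) (k : K) :
    L.term a (x + y) k = L.term a x k * Complex.exp (inner ℝ (intPoint a) y : ℝ) := by
  rw [term, term, inner_add_right, Complex.ofReal_add, Complex.exp_add]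
  ring

theorem norm_term (a : Fin n → ℤ) (x : EuclideanSpace ℝ (Fin n)) (k : K) :
    ‖L.term a x k‖ = ‖L.q a k‖ * Real.exp (inner ℝ (intPoint a) x) := by
  rw [term, norm_mul, Complex.norm_exp, Complex.ofReal_re]

@[fun_prop]
theorem continuous_term (a : Fin n → ℤ) :
    Continuous fun p : EuclideanSpace ℝ (Fin n) × K => L.term a p.1 p.2 := by
  have := L.continuous_q a
  unfold term
  fun_prop

@[fun_prop]
theorem continuous_eval : Continuous fun p : EuclideanSpace ℝ (Fin n) × K => L.eval p.1 p.2 := by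
  unfold eval
  fun_prop

@[fun_prop]
theorem continuous_dirDeriv (u : EuclideanSpace ℝ (Fin n)) :
    Continuous fun p : EuclideanSpace ℝ (Fin n) × K => L.dirDeriv u p.1 p.2 := by
  unfold dirDeriv
  fun_prop

theorem continuous_eval_act (v : EuclideanSpace ℝ (Fin n)) :
    Continuous fun p : (EuclideanSpace ℝ (Fin n) × K) × ℝ =>
      L.eval p.1.1 (L.act (p.2 • v) p.1.2) := by
  simp only [eval, term_act]
  have := L.continuous_term
  refine continuous_finsetSum _ fun a _ => ?_
  exact ((this a).comp continuous_fst).mul (by fun_prop)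

theorem continuous_dirDeriv_act (u v : EuclideanSpace ℝ (Fin n)) :
    Continuous fun p : (EuclideanSpace ℝ (Fin n) × K) × ℝ =>
      L.dirDeriv u p.1.1 (L.act (p.2 • v) p.1.2) := by
  simp only [dirDeriv, term_act]
  have := L.continuous_term
  refine continuous_finsetSum _ fun a _ => ?_
  exact continuous_const.mul (((this a).comp continuous_fst).mul (by fun_prop))

theorem isOpen_amoebaCompl [CompactSpace K] : IsOpen L.amoebaCompl := by
  have h : IsClosed {p : EuclideanSpace ℝ (Fin n) × K | L.eval p.1 p.2 = 0} :=
    isClosed_eq L.continuous_eval continuous_const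
  have h2 := isClosedMap_fst_of_compactSpace _ h
  convert h2.isOpen_compl using 1
  ext x
  simp [amoebaCompl]

/-- The restriction of the Laurent polynomial with parameter `k` to the coset
`s ↦ exp x * s ^ v` of a one-parameter subgroup, made into a polynomial by a shift of exponents
by `N`. -/
noncomputable def linePoly (v : Fin n → ℤ) (N : ℕ) (x : EuclideanSpace ℝ (Fin n)) (k : K) :
    Polynomial ℂ :=
  ∑ a ∈ L.S, Polynomial.monomial (a ⬝ᵥ v + N).toNat (L.term a x k)

/-- Some shift makes the exponents of all restrictions along `v` nonnegative. -/
theorem exists_shift (v : Fin n → ℤ) : ∃ N : ℕ, ∀ a ∈ L.S, 0 ≤ a ⬝ᵥ v + N := by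
  refine ⟨∑ a ∈ L.S, (a ⬝ᵥ v).natAbs, fun a ha => ?_⟩
  have h := Finset.single_le_sum (f := fun a => (a ⬝ᵥ v).natAbs) (fun _ _ => Nat.zero_le _) ha
  omega

variable {L} {v : Fin n → ℤ} {N : ℕ} (hN : ∀ a ∈ L.S, 0 ≤ a ⬝ᵥ v + N)

include hN in
theorem exp_pow_toNat {a : Fin n → ℤ} (ha : a ∈ L.S) (c : ℂ) :
    Complex.exp c ^ (a ⬝ᵥ v + N).toNat =
      Complex.exp (N * c) * Complex.exp ((inner ℝ (intPoint a) (intPoint v) : ℝ) * c) := by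
  rw [← Complex.exp_nat_mul, ← Complex.exp_add, inner_intPoint_intPoint]
  have : (((a ⬝ᵥ v + N).toNat : ℤ) : ℂ) = (a ⬝ᵥ v : ℤ) + N := by
    rw [Int.toNat_of_nonneg (hN a ha)]
    push_cast
    rfl
  rw [Int.cast_natCast] at this
  rw [this]
  push_cast
  ring_nf

include hN in
theorem linePoly_eval_exp (x : EuclideanSpace ℝ (Fin n)) (k : K) (t : ℝ) :
    (L.linePoly v N x k).eval (Complex.exp t) =
      Complex.exp (N * t) * L.eval (x + t • intPoint v) k := by
  simp only [linePoly, eval, Polynomial.eval_finsetSum, Polynomial.eval_monomial, Finset.mul_sum,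
    term_add, inner_smul_right]
  refine Finset.sum_congr rfl fun a ha => ?_
  rw [exp_pow_toNat hN ha]
  push_cast
  ring_nf

include hN in
theorem linePoly_eval_circle (x : EuclideanSpace ℝ (Fin n)) (k : K) (τ : ℝ) :
    (L.linePoly v N x k).eval (circleMap 0 1 τ) =
      Complex.exp (N * (τ * Complex.I)) * L.eval x (L.act (τ • intPoint v) k) := by
  simp only [linePoly, eval, Polynomial.eval_finsetSum, Polynomial.eval_monomial, Finset.mul_sum,
    term_act, inner_smul_right, circleMap, zero_add, Complex.ofReal_one, one_mul]
  refine Finset.sum_congr rfl fun a ha => ?_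
  rw [exp_pow_toNat hN ha]
  push_cast
  ring_nf

include hN in
theorem linePoly_derivative_circle (x : EuclideanSpace ℝ (Fin n)) (k : K) (τ : ℝ) :
    circleMap 0 1 τ * (L.linePoly v N x k).derivative.eval (circleMap 0 1 τ) =
      Complex.exp (N * (τ * Complex.I)) *
        (L.dirDeriv (intPoint v) x (L.act (τ • intPoint v) k) +
          N * L.eval x (L.act (τ • intPoint v) k)) := by
  simp only [linePoly, eval, dirDeriv, Polynomial.derivative_sum, Polynomial.eval_finsetSum,
    Polynomial.derivative_monomial, Polynomial.eval_monomial, Finset.mul_sum,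
    term_act, ← Finset.sum_add_distrib]
  refine Finset.sum_congr rfl fun a ha => ?_
  have h1 (s : ℂ) (e : ℕ) (c : ℂ) : s * (c * e * s ^ (e - 1)) = c * e * s ^ e := by
    cases e with
    | zero => simp
    | succ e =>
      rw [Nat.add_sub_cancel, pow_succ]
      ring
  rw [h1]
  simp only [circleMap, zero_add, Complex.ofReal_one, one_mul]
  rw [exp_pow_toNat hN ha]
  have h2 : (((a ⬝ᵥ v + N).toNat : ℤ) : ℂ) = (a ⬝ᵥ v : ℤ) + N := by
    rw [Int.toNat_of_nonneg (hN a ha)]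
    push_cast
    rfl
  rw [Int.cast_natCast] at h2
  rw [h2, inner_smul_right, inner_intPoint_intPoint]
  push_cast
  ring_nf

include hN in
/-- The argument principle: winding numbers count roots in the unit disk. -/
theorem winding_add_shift {x : EuclideanSpace ℝ (Fin n)} (hx : x ∈ L.amoebaCompl) (k : K) :
    L.winding v x k + N = ((L.linePoly v N x k).roots.filter fun r => ‖r‖ < 1).card := by
  have hcirc (s : ℂ) (hs : ‖s‖ = 1) : ∃ τ : ℝ, s = circleMap 0 1 τ := by
    refine ⟨s.arg, ?_⟩
    conv_lhs => rw [← Complex.norm_mul_exp_arg_mul_I s, hs]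
    simp [circleMap]
  rw [← circleAverage_mul_derivative_div, Real.circleAverage_def, winding]
  · have hcont : Continuous fun τ : ℝ =>
        L.dirDeriv (intPoint v) x (L.act (τ • intPoint v) k) /
          L.eval x (L.act (τ • intPoint v) k) := by
      refine Continuous.div ?_ ?_ fun τ => hx _
      · exact (L.continuous_dirDeriv_act (intPoint v) (intPoint v)).comp
          (f := fun τ : ℝ => ((x, k), τ)) (by fun_prop)
      · exact (L.continuous_eval_act (intPoint v)).comp
          (f := fun τ : ℝ => ((x, k), τ)) (by fun_prop)
    have heq (τ : ℝ) : circleMap 0 1 τ * ((L.linePoly v N x k).derivative.eval (circleMap 0 1 τ) /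
        (L.linePoly v N x k).eval (circleMap 0 1 τ)) =
        L.dirDeriv (intPoint v) x (L.act (τ • intPoint v) k) /
          L.eval x (L.act (τ • intPoint v) k) + N := by
      rw [← mul_div_assoc, linePoly_derivative_circle hN, linePoly_eval_circle hN,
        mul_div_mul_left _ _ (Complex.exp_ne_zero _), add_div, mul_div_cancel_right₀ _ (hx _)]
    simp_rw [heq]
    rw [intervalIntegral.integral_add (hcont.intervalIntegrable _ _)
      (continuous_const.intervalIntegrable _ _), intervalIntegral.integral_const, smul_add,
      Complex.real_smul, Complex.ofReal_inv, sub_zero, smul_smul,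
      inv_mul_cancel₀ (by positivity), one_smul]
  · intro s hs
    obtain ⟨τ, rfl⟩ := hcirc s hs
    rw [linePoly_eval_circle hN]
    exact mul_ne_zero (Complex.exp_ne_zero _) (hx _)

variable (L) in
/-- Winding numbers are integers that depend continuously on all data, hence constant on
connected sets. -/
theorem exists_winding_eq [ConnectedSpace K] {E : Set (EuclideanSpace ℝ (Fin n))}
    (hE : IsPreconnected E) (hEne : E.Nonempty) (hEc : E ⊆ L.amoebaCompl) (v : Fin n → ℤ) :
    ∃ z : ℤ, ∀ x ∈ E, ∀ k, L.winding v x k = z := by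
  obtain ⟨N, hN⟩ := L.exists_shift v
  have : PreconnectedSpace E := isPreconnected_iff_preconnectedSpace.1 hE
  have hcont : Continuous fun p : E × K => L.winding v p.1 p.2 := by
    unfold winding
    refine continuous_const.mul
      (intervalIntegral.continuous_parametric_intervalIntegral_of_continuous' ?_ _ _)
    refine Continuous.div ?_ ?_ fun p => hEc p.1.1.2 _
    · exact (L.continuous_dirDeriv_act (intPoint v) (intPoint v)).comp
        (f := fun p : (E × K) × ℝ => ((p.1.1.1, p.1.2), p.2)) (by fun_prop)
    · exact (L.continuous_eval_act (intPoint v)).comp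
        (f := fun p : (E × K) × ℝ => ((p.1.1.1, p.1.2), p.2)) (by fun_prop)
  have hint (p : E × K) : ∃ z : ℤ, L.winding v p.1 p.2 = z := by
    refine ⟨((L.linePoly v N p.1 p.2).roots.filter fun r => ‖r‖ < 1).card - N, ?_⟩
    rw [eq_sub_of_add_eq (winding_add_shift hN (hEc p.1.2) p.2)]
    push_cast
    rfl
  choose z hz using hint
  have hzc : Continuous z := by
    refine (Int.isClosedEmbedding_coe_real.continuous_iff).2 ?_
    have h : (fun p => ((z p : ℤ) : ℝ)) = fun p : E × K => (L.winding v p.1 p.2).re := by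
      ext p
      rw [hz p, Complex.intCast_re]
    change Continuous fun p => ((z p : ℤ) : ℝ)
    rw [h]
    exact Complex.continuous_re.comp hcont
  obtain ⟨x₀, hx₀⟩ := hEne
  obtain ⟨k₀⟩ := (inferInstance : Nonempty K)
  refine ⟨z (⟨x₀, hx₀⟩, k₀), fun x hx k => ?_⟩
  rw [hz (⟨x, hx⟩, k), PreconnectedSpace.constant inferInstance hzc]

end LaurentFamily

/-! ### The gradient of the Ronkin function -/

namespace LaurentFamily

variable {n : ℕ} {K : Type*} [TopologicalSpace K] (L : LaurentFamily n K)

/-- The derivative of `x ↦ log ‖L.eval x k‖`. -/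
noncomputable def logDeriv (x : EuclideanSpace ℝ (Fin n)) (k : K) :
    EuclideanSpace ℝ (Fin n) →L[ℝ] ℝ :=
  ∑ a ∈ L.S, (L.term a x k / L.eval x k).re • innerSL ℝ (intPoint a)

/-- The Ronkin function of the family: the mean of `log ‖L.eval x k‖` over the parameters `k`. -/
noncomputable def ronkin [MeasurableSpace K] (μ : Measure K) (x : EuclideanSpace ℝ (Fin n)) : ℝ :=
  ∫ k, Real.log ‖L.eval x k‖ ∂μ

theorem logDeriv_apply (x u : EuclideanSpace ℝ (Fin n)) (k : K) :
    L.logDeriv x k u = (L.dirDeriv u x k / L.eval x k).re := by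
  simp only [logDeriv, dirDeriv, _root_.sum_apply, _root_.smul_apply,
    innerSL_apply_apply, smul_eq_mul, Finset.sum_div, Complex.re_sum, mul_div_assoc,
    Complex.re_ofReal_mul]
  exact Finset.sum_congr rfl fun a _ => mul_comm _ _

theorem hasFDerivAt_log_norm_eval {x : EuclideanSpace ℝ (Fin n)} {k : K} (h : L.eval x k ≠ 0) :
    HasFDerivAt (fun x => Real.log ‖L.eval x k‖) (L.logDeriv x k) x := by
  have h1 : HasFDerivAt (fun x => L.eval x k)
      (∑ a ∈ L.S, (Complex.ofRealCLM.comp (innerSL ℝ (intPoint a))).smulRight (L.term a x k))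
      x := by
    refine HasFDerivAt.fun_sum fun a _ => ?_
    have h2 : HasFDerivAt (fun x : EuclideanSpace ℝ (Fin n) => ((inner ℝ (intPoint a) x : ℝ) : ℂ))
        (Complex.ofRealCLM.comp (innerSL ℝ (intPoint a))) x :=
      (Complex.ofRealCLM.comp (innerSL ℝ (intPoint a))).hasFDerivAt
    have h3 := (h2.cexp).const_mul (L.q a k)
    refine h3.congr_fderiv ?_
    ext u
    simp only [ContinuousLinearMap.smulRight_apply, _root_.smul_apply, smul_eq_mul,
      ContinuousLinearMap.comp_apply, Complex.ofRealCLM_apply, term]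
    ring
  have h4 := h1.norm_sq.log (by simpa using h)
  have h5 : (fun x => Real.log ‖L.eval x k‖) =
      fun x => (1 / 2 : ℝ) * Real.log (‖L.eval x k‖ ^ 2) := by
    ext x
    rw [Real.log_pow]
    push_cast
    ring
  rw [h5]
  refine (h4.const_mul (1 / 2 : ℝ)).congr_fderiv ?_
  ext u
  have h6 (z : ℂ) : (z / L.eval x k).re = (‖L.eval x k‖ ^ 2)⁻¹ * inner ℝ (L.eval x k) z := by
    rw [Complex.div_re, Complex.inner, ← Complex.normSq_eq_norm_sq]
    simp
    ring
  rw [logDeriv_apply, dirDeriv, h6]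
  simp only [_root_.smul_apply, smul_eq_mul, ContinuousLinearMap.comp_apply, _root_.sum_apply,
    ContinuousLinearMap.smulRight_apply, Complex.ofRealCLM_apply, innerSL_apply_apply, nsmul_eq_mul]
  push_cast
  ring

theorem continuousOn_logDeriv :
    ContinuousOn (fun p : EuclideanSpace ℝ (Fin n) × K => L.logDeriv p.1 p.2)
      (L.amoebaCompl ×ˢ Set.univ) := by
  unfold logDeriv
  refine continuousOn_finsetSum _ fun a _ => ContinuousOn.fun_smul ?_ continuousOn_const
  refine Complex.continuous_re.comp_continuousOn ?_
  exact (L.continuous_term a).continuousOn.div L.continuous_eval.continuousOn fun p hp => hp.1 p.2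

theorem continuous_logDeriv {x : EuclideanSpace ℝ (Fin n)} (hx : x ∈ L.amoebaCompl) :
    Continuous fun k => L.logDeriv x k := by
  have := L.continuousOn_logDeriv.comp_continuous (f := fun k : K => (x, k)) (by fun_prop)
    fun k => ⟨hx, trivial⟩
  exact this

variable [CompactSpace K] [MeasurableSpace K] [BorelSpace K] (μ : Measure K)
  [IsProbabilityMeasure μ]

/-- A bounded continuous function on a probability space is integrable. -/
theorem integrable_of_continuous {V : Type*} [NormedAddCommGroup V]
    [SecondCountableTopology V] {g : K → V} (hg : Continuous g) : Integrable g μ := by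
  obtain ⟨C, hC⟩ := isCompact_univ.exists_bound_of_continuousOn hg.continuousOn
  exact Integrable.of_bound hg.aestronglyMeasurable C
    (Filter.Eventually.of_forall fun k => hC k trivial)

/-- Differentiation of the Ronkin function under the integral sign, off the amoeba. -/
theorem hasFDerivAt_ronkin {x : EuclideanSpace ℝ (Fin n)} (hx : x ∈ L.amoebaCompl) :
    HasFDerivAt (L.ronkin μ) (∫ k, L.logDeriv x k ∂μ) x := by
  obtain ⟨r, hr, hball⟩ := Metric.nhds_basis_closedBall.mem_iff.1
    (L.isOpen_amoebaCompl.mem_nhds hx)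
  obtain ⟨C, hC⟩ := ((isCompact_closedBall x r).prod
    (isCompact_univ (X := K))).exists_bound_of_continuousOn
      (L.continuousOn_logDeriv.mono (Set.prod_mono hball subset_rfl))
  have hlog {y : EuclideanSpace ℝ (Fin n)} (hy : y ∈ L.amoebaCompl) :
      Continuous fun k => Real.log ‖L.eval y k‖ := by
    refine Continuous.log ?_ fun k => norm_ne_zero_iff.2 (hy k)
    exact (L.continuous_eval.comp (f := fun k : K => (y, k)) (by fun_prop)).norm
  refine hasFDerivAt_integral_of_dominated_of_fderiv_le (bound := fun _ => C)
    (F := fun y k => Real.log ‖L.eval y k‖) (F' := fun y k => L.logDeriv y k)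
    (Metric.closedBall_mem_nhds x hr) ?_ (integrable_of_continuous μ (hlog hx)) ?_ ?_
    (integrable_const C) ?_
  · filter_upwards [L.isOpen_amoebaCompl.mem_nhds hx] with y hy
    exact (hlog hy).aestronglyMeasurable
  · exact (L.continuous_logDeriv hx).aestronglyMeasurable
  · exact Filter.Eventually.of_forall fun k y hy => hC (y, k) ⟨hy, trivial⟩
  · exact Filter.Eventually.of_forall fun k y hy => L.hasFDerivAt_log_norm_eval (hball hy k)

variable (hact : ∀ θ, MeasurePreserving (L.act θ) μ μ)

include hact in
/-- The mean of the winding numbers is the mean of the logarithmic derivatives, since the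
torus action preserves the measure. -/
theorem integral_dirDeriv_div_eval (v : Fin n → ℤ) {x : EuclideanSpace ℝ (Fin n)}
    (hx : x ∈ L.amoebaCompl) :
    ∫ k, L.dirDeriv (intPoint v) x k / L.eval x k ∂μ = ∫ k, L.winding v x k ∂μ := by
  set h : K → ℂ := fun k => L.dirDeriv (intPoint v) x k / L.eval x k with hh
  have hcont : Continuous h := by
    refine Continuous.div ?_ ?_ fun k => hx k
    · exact (L.continuous_dirDeriv (intPoint v)).comp (f := fun k : K => (x, k)) (by fun_prop)
    · exact L.continuous_eval.comp (f := fun k : K => (x, k)) (by fun_prop)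
  have hcont2 : Continuous fun p : K × ℝ => h (L.act (p.2 • intPoint v) p.1) := by
    refine Continuous.div ?_ ?_ fun p => hx _
    · exact (L.continuous_dirDeriv_act (intPoint v) (intPoint v)).comp
        (f := fun p : K × ℝ => ((x, p.1), p.2)) (by fun_prop)
    · exact (L.continuous_eval_act (intPoint v)).comp
        (f := fun p : K × ℝ => ((x, p.1), p.2)) (by fun_prop)
  obtain ⟨C, hC⟩ := isCompact_univ.exists_bound_of_continuousOn hcont.continuousOn
  have hint : Integrable (fun p : K × ℝ => h (L.act (p.2 • intPoint v) p.1))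
      (μ.prod (volume.restrict (Set.Ioc 0 (2 * Real.pi)))) :=
    Integrable.of_bound hcont2.aestronglyMeasurable C
      (Filter.Eventually.of_forall fun p => hC _ trivial)
  have hinv (τ : ℝ) : ∫ k, h (L.act (τ • intPoint v) k) ∂μ = ∫ k, h k ∂μ := by
    rw [← (hact (τ • intPoint v)).map_eq]
    rw [integral_map (hact _).measurable.aemeasurable hcont.aestronglyMeasurable, (hact _).map_eq]
  simp only [winding]
  rw [integral_const_mul]
  simp_rw [intervalIntegral.integral_of_le Real.two_pi_pos.le]
  have hswap := integral_integral_swap (f := fun k τ => h (L.act (τ • intPoint v) k)) hint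
  simp only [hinv] at hswap
  refine Eq.symm ((congrArg (fun c => ((2 * Real.pi : ℝ) : ℂ)⁻¹ * c) hswap).trans ?_)
  rw [integral_const, measureReal_restrict_apply_univ,
    Real.volume_real_Ioc_of_le Real.two_pi_pos.le, sub_zero, Complex.real_smul,
    inv_mul_cancel_left₀]
  exact_mod_cast Real.two_pi_pos.ne'

include hact in
/-- On a connected set off the amoeba, the gradient of the Ronkin function is the integral vector
whose products with integral directions are the winding numbers. -/
theorem exists_gradient_eq_winding [ConnectedSpace K] {E : Set (EuclideanSpace ℝ (Fin n))}
    (hE : IsPreconnected E) (hEne : E.Nonempty) (hEc : E ⊆ L.amoebaCompl) :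
    ∃ m : Fin n → ℤ, (∀ x ∈ E, HasGradientAt (L.ronkin μ) (intPoint m) x) ∧
      ∀ v, ∀ x ∈ E, ∀ k, L.winding v x k = (m ⬝ᵥ v : ℤ) := by
  choose z hz using L.exists_winding_eq hE hEne hEc
  have hD {x} (hx : x ∈ E) (v : Fin n → ℤ) :
      (∫ k, L.logDeriv x k ∂μ) (intPoint v) = z v := by
    have hcont : Continuous fun k => L.dirDeriv (intPoint v) x k / L.eval x k := by
      refine Continuous.div ?_ ?_ fun k => hEc hx k
      · exact (L.continuous_dirDeriv (intPoint v)).comp (f := fun k : K => (x, k)) (by fun_prop)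
      · exact L.continuous_eval.comp (f := fun k : K => (x, k)) (by fun_prop)
    rw [ContinuousLinearMap.integral_apply
      (integrable_of_continuous μ (L.continuous_logDeriv (hEc hx)))]
    simp only [logDeriv_apply]
    have h1 := integral_re (𝕜 := ℂ) (integrable_of_continuous μ hcont)
    simp only [RCLike.re_to_complex] at h1
    rw [h1, L.integral_dirDeriv_div_eval μ hact v (hEc hx)]
    simp [hz v x hx]
  let m : Fin n → ℤ := fun i => z (Pi.single i 1)
  have hm {x} (hx : x ∈ E) : ∫ k, L.logDeriv x k ∂μ = innerSL ℝ (intPoint m) := by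
    refine ContinuousLinearMap.coe_injective
      ((EuclideanSpace.basisFun (Fin n) ℝ).toBasis.ext fun i => ?_)
    have h1 : EuclideanSpace.single i (1 : ℝ) = intPoint (Pi.single i 1) := by
      ext j
      by_cases h : j = i <;> simp [intPoint, Pi.single_apply, h]
    simp only [OrthonormalBasis.coe_toBasis, EuclideanSpace.basisFun_apply,
      ContinuousLinearMap.coe_coe, innerSL_apply_apply]
    rw [h1, hD hx, inner_intPoint_intPoint, dotProduct_single_one]
  refine ⟨m, fun x hx => ?_, fun v x hx k => ?_⟩
  · rw [hasGradientAt_iff_hasFDerivAt]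
    refine (L.hasFDerivAt_ronkin μ (hEc hx)).congr_fderiv ?_
    rw [hm hx]
    rfl
  · have := hD hx v
    rw [hm hx, innerSL_apply_apply, inner_intPoint_intPoint] at this
    rw [hz v x hx k]
    exact_mod_cast this.symm

end LaurentFamily

/-! ### The order of a component and its recession cone -/

/-- Some value of a trigonometric polynomial on the compact torus is at least as large as a given
coefficient: any other coefficient can be removed by averaging two translates. -/
theorem exists_norm_coeff_le {n : ℕ} (a₀ : Fin n → ℤ) (M : Finset (Fin n → ℤ)) (hM : a₀ ∉ M)
    (c : (Fin n → ℤ) → ℂ) :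
    ∃ θ : EuclideanSpace ℝ (Fin n), ‖c a₀‖ ≤
      ‖∑ a ∈ insert a₀ M, c a * Complex.exp ((inner ℝ (intPoint a) θ : ℝ) * Complex.I)‖ := by
  induction M using Finset.induction_on generalizing c with
  | empty => exact ⟨0, by simp⟩
  | insert b M hb ih =>
    have hba : b ≠ a₀ := fun h => hM (h ▸ Finset.mem_insert_self _ _)
    have hMa : a₀ ∉ M := fun h => hM (Finset.mem_insert_of_mem h)
    set e : (Fin n → ℤ) → EuclideanSpace ℝ (Fin n) → ℂ := fun a θ =>
      Complex.exp ((inner ℝ (intPoint a) θ : ℝ) * Complex.I) with he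
    have hadd (a : Fin n → ℤ) (θ η : EuclideanSpace ℝ (Fin n)) :
        e a (θ + η) = e a θ * e a η := by
      simp only [he, inner_add_right, Complex.ofReal_add, add_mul, Complex.exp_add]
    have hnorm (a : Fin n → ℤ) (θ : EuclideanSpace ℝ (Fin n)) : ‖e a θ‖ = 1 :=
      Complex.norm_exp_ofReal_mul_I _
    -- a translation vector which has opposite effects on the frequencies `a₀` and `b`
    obtain ⟨η, hη⟩ : ∃ η, e b η = -e a₀ η := by
      obtain ⟨i, hi⟩ := Function.ne_iff.1 hba
      have hd : ((b i : ℝ) - a₀ i) ≠ 0 := sub_ne_zero.2 (by exact_mod_cast hi)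
      refine ⟨EuclideanSpace.single i (Real.pi / (b i - a₀ i)), ?_⟩
      have h1 (a : Fin n → ℤ) : inner ℝ (intPoint a)
          (EuclideanSpace.single i (Real.pi / (b i - a₀ i) : ℝ)) =
            a i * (Real.pi / (b i - a₀ i)) := by
        rw [inner_intPoint]
        simp
      simp only [he, h1]
      have h2 : (b i : ℝ) * (Real.pi / (b i - a₀ i)) =
          a₀ i * (Real.pi / (b i - a₀ i)) + Real.pi := by
        field_simp
        ring
      rw [h2, Complex.ofReal_add, add_mul, Complex.exp_add, Complex.exp_pi_mul_I]
      ring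
    set g : EuclideanSpace ℝ (Fin n) → ℂ := fun θ => ∑ a ∈ insert a₀ (insert b M), c a * e a θ
      with hg
    have he0 : e a₀ η ≠ 0 := Complex.exp_ne_zero _
    obtain ⟨θ, hθ⟩ := ih hMa fun a => c a * ((1 + e a η / e a₀ η) / 2)
    have h1 : ∑ a ∈ insert a₀ M, c a * ((1 + e a η / e a₀ η) / 2) * e a θ =
        (g θ + (e a₀ η)⁻¹ * g (θ + η)) / 2 := by
      have hb' : b ∉ insert a₀ M := by simp [hba, hb]
      simp only [hg]
      rw [Finset.insert_comm, Finset.sum_insert hb', Finset.sum_insert hb', hadd, hη]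
      simp only [hadd, mul_add, add_div, Finset.mul_sum, Finset.sum_div]
      rw [show ∀ A B C D : ℂ, A + B + (C + D) = (A + C) + (B + D) from fun _ _ _ _ => by ring,
        ← Finset.sum_add_distrib]
      have h2 : c b * e b θ / 2 + (e a₀ η)⁻¹ * (c b * (e b θ * -e a₀ η)) / 2 = 0 := by
        field_simp
        ring
      rw [h2, zero_add]
      refine Finset.sum_congr rfl fun a _ => ?_
      field_simp
    have h3 : ‖c a₀‖ ≤ (‖g θ‖ + ‖g (θ + η)‖) / 2 := by
      refine hθ.trans_eq' ?_ |>.trans ?_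
      · rw [div_self he0]
        norm_num
      · rw [h1, norm_div, Complex.norm_ofNat]
        gcongr
        refine (norm_add_le _ _).trans_eq ?_
        rw [norm_mul, norm_inv, hnorm, inv_one, one_mul]
    by_cases h4 : ‖c a₀‖ ≤ ‖g θ‖
    · exact ⟨θ, h4⟩
    · exact ⟨θ + η, by linarith⟩

namespace LaurentFamily

variable {n : ℕ} {K : Type*} [TopologicalSpace K] {L : LaurentFamily n K}

theorem exists_natDegree_linePoly {v : Fin n → ℤ} {N : ℕ} (hN : ∀ a ∈ L.S, 0 ≤ a ⬝ᵥ v + N)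
    {x : EuclideanSpace ℝ (Fin n)} {k : K} (h : L.linePoly v N x k ≠ 0) :
    ∃ a ∈ L.S, ((L.linePoly v N x k).natDegree : ℤ) = a ⬝ᵥ v + N := by
  have h1 := Polynomial.leadingCoeff_ne_zero.2 h
  rw [Polynomial.leadingCoeff] at h1
  nth_rw 1 [linePoly] at h1
  rw [Polynomial.finsetSum_coeff] at h1
  obtain ⟨a, ha, h2⟩ := Finset.exists_ne_zero_of_sum_ne_zero h1
  rw [Polynomial.coeff_monomial] at h2
  refine ⟨a, ha, ?_⟩
  rw [← Int.toNat_of_nonneg (hN a ha)]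
  by_contra h3
  exact h2 (if_neg fun h4 => h3 (by rw [h4]))

theorem linePoly_ne_zero {v : Fin n → ℤ} {N : ℕ} (hN : ∀ a ∈ L.S, 0 ≤ a ⬝ᵥ v + N)
    {x : EuclideanSpace ℝ (Fin n)} (hx : x ∈ L.amoebaCompl) (k : K) : L.linePoly v N x k ≠ 0 := by
  intro h
  have h1 := linePoly_eval_exp hN x k 0
  rw [h] at h1
  simp only [Polynomial.eval_zero, zero_smul, add_zero] at h1
  exact mul_ne_zero (Complex.exp_ne_zero _) (hx k) h1.symm

section Order

/-- The integer vector `m` encodes the winding numbers of the family on `E`. -/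
def IsOrder (L : LaurentFamily n K) (E : Set (EuclideanSpace ℝ (Fin n))) (m : Fin n → ℤ) : Prop :=
  ∀ v, ∀ x ∈ E, ∀ k, L.winding v x k = (m ⬝ᵥ v : ℤ)

variable {E : Set (EuclideanSpace ℝ (Fin n))} {m : Fin n → ℤ} (hEc : E ⊆ L.amoebaCompl)
  (hm : L.IsOrder E m)

include hEc hm

/-- The order counts, up to the shift, the roots in the unit disk. -/
theorem IsOrder.card_roots {v : Fin n → ℤ} {N : ℕ} (hN : ∀ a ∈ L.S, 0 ≤ a ⬝ᵥ v + N)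
    {x : EuclideanSpace ℝ (Fin n)} (hx : x ∈ E) (k : K) :
    (((L.linePoly v N x k).roots.filter fun r => ‖r‖ < 1).card : ℤ) = m ⬝ᵥ v + N := by
  have h := winding_add_shift hN (hEc hx) k
  rw [hm v x hx k] at h
  exact_mod_cast h.symm

theorem IsOrder.mem_convexHull [Nonempty K] (hne : E.Nonempty) :
    intPoint m ∈ convexHull ℝ (intPoint '' (L.S : Set (Fin n → ℤ))) := by
  refine intPoint_mem_convexHull L.S.finite_toSet fun v => ?_
  obtain ⟨x, hx⟩ := hne
  obtain ⟨k⟩ := ‹Nonempty K›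
  obtain ⟨N, hN⟩ := L.exists_shift v
  obtain ⟨a, ha, hdeg⟩ := exists_natDegree_linePoly hN (linePoly_ne_zero hN (hEc hx) k)
  refine ⟨a, ha, ?_⟩
  have h1 := hm.card_roots hEc hN hx k
  have h2 := card_roots_filter_le (L.linePoly v N x k)
  omega

/-- Along an integral direction `v` which is maximal on the Newton polytope at the order, all
roots of the restrictions to lines are used up by the winding number, so the ray issued from `x`
stays off the amoeba. -/
theorem IsOrder.add_smul_intPoint_mem {v : Fin n → ℤ} (hv : ∀ a ∈ L.S, a ⬝ᵥ v ≤ m ⬝ᵥ v)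
    {x : EuclideanSpace ℝ (Fin n)} (hx : x ∈ E) {t : ℝ} (ht : 0 ≤ t) :
    x + t • intPoint v ∈ L.amoebaCompl := by
  intro k h0
  obtain ⟨N, hN⟩ := L.exists_shift v
  have hp := linePoly_ne_zero hN (hEc hx) k
  obtain ⟨a, ha, hdeg⟩ := exists_natDegree_linePoly hN hp
  have h1 := hm.card_roots hEc hN hx k
  have h2 := hv a ha
  refine eval_ne_zero_of_natDegree_le_card (s := Complex.exp t) hp (by omega) ?_ ?_
  · rw [Complex.norm_exp, Complex.ofReal_re]
    exact Real.one_le_exp ht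
  · rw [linePoly_eval_exp hN, h0, mul_zero]

theorem IsOrder.add_smul_mem (hEo : IsOpen E) {w : EuclideanSpace ℝ (Fin n)}
    (hw : ∀ a ∈ L.S, inner ℝ (intPoint a) w ≤ inner ℝ (intPoint m) w)
    {x : EuclideanSpace ℝ (Fin n)} (hx : x ∈ E) {t : ℝ} (ht : 0 ≤ t) :
    x + t • w ∈ L.amoebaCompl := by
  have hU : ∀ᶠ w' in nhds w, x + t • (w - w') ∈ E ∧
      ∀ a ∈ L.S, inner ℝ (intPoint a) w < inner ℝ (intPoint m) w →
        inner ℝ (intPoint a) w' < inner ℝ (intPoint m) w' := by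
    refine Filter.Eventually.and ?_ ((Filter.eventually_all_finset _).2 fun a _ => ?_)
    · have hc : Continuous fun w' => x + t • (w - w') := by fun_prop
      refine hc.continuousAt.eventually_mem (hEo.mem_nhds ?_)
      simpa using hx
    · by_cases h : inner ℝ (intPoint a) w < inner ℝ (intPoint m) w
      · filter_upwards [ContinuousAt.eventually_lt (f := fun w' => inner ℝ (intPoint a) w')
          (g := fun w' => inner ℝ (intPoint m) w') (by fun_prop) (by fun_prop) h] with w' h' _
        exact h'
      · exact Filter.Eventually.of_forall fun _ h' => absurd h' h
  -- Replace `w` by a rational direction and move the base point inside `E` so that the end point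
  -- `x + t • w` stays the same.
  obtain ⟨v, N, hN, ⟨hv1, hv2⟩, hv3⟩ := exists_int_direction_near w hU
  have hv (a) (ha : a ∈ L.S) : a ⬝ᵥ v ≤ m ⬝ᵥ v := by
    rcases (hw a ha).eq_or_lt with h | h
    · have h1 := hv3 (a - m) (by
        rw [inner_intPoint] at h ⊢
        rw [inner_intPoint] at h
        simp [sub_mul, h])
      rw [sub_dotProduct] at h1
      omega
    · have h1 := hv2 a ha h
      rw [inner_smul_right, inner_smul_right, inner_intPoint_intPoint, inner_intPoint_intPoint,
        mul_lt_mul_iff_right₀ (by positivity)] at h1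
      exact_mod_cast h1.le
  have h := hm.add_smul_intPoint_mem hEc hv hv1 (t := t * (N : ℝ)⁻¹) (by positivity)
  convert h using 1
  rw [smul_sub, smul_smul]
  abel

/-- If `E` contains points escaping to infinity in the direction `w`, then `w` is maximal on the
Newton polytope at the order: far away the terms on the face exposed by `w` dominate, so that
winding numbers along nearby rational directions are given by the exponents on that face. -/
theorem IsOrder.inner_le_of_tendsto {w : EuclideanSpace ℝ (Fin n)}
    {x : ℕ → EuclideanSpace ℝ (Fin n)} (hx : ∀ j, x j ∈ E)
    (hx1 : Filter.Tendsto (fun j => ‖x j‖) Filter.atTop Filter.atTop)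
    (hx2 : Filter.Tendsto (fun j => ‖x j‖⁻¹ • x j) Filter.atTop (nhds w)) {a : Fin n → ℤ}
    (ha : a ∈ L.S) : inner ℝ (intPoint a) w ≤ inner ℝ (intPoint m) w := by
  obtain ⟨a₀, ha₀, hmax⟩ := L.S.exists_max_image (fun a => inner ℝ (intPoint a) w) ⟨a, ha⟩
  refine (hmax a ha).trans ?_
  by_contra! hlt
  have hU : ∀ᶠ w' in nhds w, inner ℝ (intPoint m) w' < inner ℝ (intPoint a₀) w' ∧
      ∀ a ∈ L.S, inner ℝ (intPoint a) w < inner ℝ (intPoint a₀) w →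
        inner ℝ (intPoint a) w' < inner ℝ (intPoint a₀) w' := by
    have h1 (a b : Fin n → ℤ) (h : inner ℝ (intPoint a) w < inner ℝ (intPoint b) w) :
        ∀ᶠ w' in nhds w, inner ℝ (intPoint a) w' < inner ℝ (intPoint b) w' :=
      ContinuousAt.eventually_lt (by fun_prop) (by fun_prop) h
    refine (h1 _ _ hlt).and ((Filter.eventually_all_finset _).2 fun a _ => ?_)
    by_cases h : inner ℝ (intPoint a) w < inner ℝ (intPoint a₀) w
    · filter_upwards [h1 _ _ h] with w' h' _
      exact h'
    · exact Filter.Eventually.of_forall fun _ h' => absurd h' h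
  obtain ⟨v, N', hN', ⟨hv1, hv2⟩, hv3⟩ := exists_int_direction_near w hU
  have hscale (a b : Fin n → ℤ) : inner ℝ (intPoint a) ((N' : ℝ)⁻¹ • intPoint v) <
      inner ℝ (intPoint b) ((N' : ℝ)⁻¹ • intPoint v) ↔ a ⬝ᵥ v < b ⬝ᵥ v := by
    rw [inner_smul_right, inner_smul_right, inner_intPoint_intPoint, inner_intPoint_intPoint,
      mul_lt_mul_iff_right₀ (by positivity)]
    exact_mod_cast Iff.rfl
  rw [hscale] at hv1
  obtain ⟨N, hN⟩ := L.exists_shift v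
  -- The exponents of highest degree along `v` are those on the face exposed by `w`.
  have hiff (a) (ha : a ∈ L.S) : a ⬝ᵥ v = a₀ ⬝ᵥ v ↔
      inner ℝ (intPoint a) w = inner ℝ (intPoint a₀) w := by
    constructor
    · intro h
      by_contra h'
      have := (hscale a a₀).1 (hv2 a ha (lt_of_le_of_ne (hmax a ha) h'))
      omega
    · intro h
      have h1 := hv3 (a - a₀) (by
        rw [inner_intPoint] at h ⊢
        rw [inner_intPoint] at h
        simp [sub_mul, h])
      rw [sub_dotProduct] at h1
      omega
  have hle (a) (ha : a ∈ L.S) : a ⬝ᵥ v ≤ a₀ ⬝ᵥ v := by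
    rcases (hmax a ha).eq_or_lt with h | h
    · exact ((hiff a ha).2 h).le
    · exact ((hscale a a₀).1 (hv2 a ha h)).le
  obtain ⟨k₀, hk₀⟩ := L.exists_q_ne_zero a₀ ha₀
  -- Far out in the direction `w`, a term on the face beats the sum of all terms off the face.
  have hdom : ∀ᶠ j in Filter.atTop,
      ∑ a ∈ L.S with a ⬝ᵥ v ≠ a₀ ⬝ᵥ v, ‖L.term a (x j) k₀‖ < ‖L.term a₀ (x j) k₀‖ := by
    have h1 : Filter.Tendsto (fun j => ∑ a ∈ L.S with a ⬝ᵥ v ≠ a₀ ⬝ᵥ v,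
        ‖L.q a k₀‖ * Real.exp (inner ℝ (intPoint a) (x j) - inner ℝ (intPoint a₀) (x j)))
        Filter.atTop (nhds 0) := by
      suffices h : ∀ a ∈ L.S.filter fun a => a ⬝ᵥ v ≠ a₀ ⬝ᵥ v, Filter.Tendsto (fun j => ‖L.q a k₀‖ *
          Real.exp (inner ℝ (intPoint a) (x j) - inner ℝ (intPoint a₀) (x j)))
          Filter.atTop (nhds 0) by
        simpa only [Finset.sum_const_zero] using tendsto_finsetSum _ h
      intro a ha
      obtain ⟨ha, hav⟩ := Finset.mem_filter.1 ha
      have h2 : inner ℝ (intPoint a) w - inner ℝ (intPoint a₀) w < 0 :=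
        sub_neg.2 (lt_of_le_of_ne (hmax a ha) fun h => hav ((hiff a ha).2 h))
      have h3 : Filter.Tendsto (fun j => ‖x j‖ * (inner ℝ (intPoint a) (‖x j‖⁻¹ • x j) -
          inner ℝ (intPoint a₀) (‖x j‖⁻¹ • x j))) Filter.atTop Filter.atBot :=
        hx1.atTop_mul_neg h2 ((tendsto_const_nhds.inner hx2).sub (tendsto_const_nhds.inner hx2))
      have h4 : Filter.Tendsto (fun j => inner ℝ (intPoint a) (x j) - inner ℝ (intPoint a₀) (x j))
          Filter.atTop Filter.atBot := by
        refine h3.congr' ?_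
        filter_upwards [hx1.eventually_gt_atTop 0] with j hj
        rw [inner_smul_right, inner_smul_right, ← mul_sub, mul_inv_cancel_left₀ hj.ne']
      simpa using (Real.tendsto_exp_atBot.comp h4).const_mul ‖L.q a k₀‖
    filter_upwards [h1.eventually_lt_const (norm_pos_iff.2 hk₀)] with j hj
    have h5 := mul_lt_mul_of_pos_right hj (Real.exp_pos (inner ℝ (intPoint a₀) (x j)))
    rw [Finset.sum_mul] at h5
    rw [norm_term]
    refine lt_of_eq_of_lt (Finset.sum_congr rfl fun a _ => ?_) h5
    rw [norm_term, mul_assoc, ← Real.exp_add, sub_add_cancel]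
  obtain ⟨j, hj⟩ := hdom.exists
  -- After a rotation, the sum over the face is at least as large as one of its terms.
  set M := (L.S.filter fun a => a ⬝ᵥ v = a₀ ⬝ᵥ v).erase a₀ with hM
  have hins : insert a₀ M = L.S.filter fun a => a ⬝ᵥ v = a₀ ⬝ᵥ v :=
    Finset.insert_erase (Finset.mem_filter.2 ⟨ha₀, rfl⟩)
  obtain ⟨θ, hθ⟩ := exists_norm_coeff_le a₀ M (Finset.notMem_erase _ _)
    fun a => L.term a (x j) k₀
  have h0 := hN a₀ ha₀
  have hcast (a) (ha : a ∈ L.S) :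
      (a ⬝ᵥ v + N).toNat = (a₀ ⬝ᵥ v + N).toNat ↔ a ⬝ᵥ v = a₀ ⬝ᵥ v := by
    have := hN a ha
    omega
  have hcard := card_roots_filter_eq_of_dominant L.S (fun a => L.term a (x j) (L.act θ k₀))
    (fun a => (a ⬝ᵥ v + N).toNat) (a₀ ⬝ᵥ v + N).toNat (fun a ha => by
      have := hle a ha
      omega) (by
      rw [Finset.filter_congr hcast, Finset.filter_congr (fun a ha => not_congr (hcast a ha))]
      rw [hins] at hθ
      simp only [term_act]
      refine lt_of_eq_of_lt (Finset.sum_congr rfl fun a _ => ?_) (hj.trans_le hθ)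
      rw [norm_mul, Complex.norm_exp_ofReal_mul_I, mul_one])
  have h1 := hm.card_roots hEc hN (hx j) (L.act θ k₀)
  rw [linePoly, hcard] at h1
  omega

theorem IsOrder.mem_normalCone_of_ray {w x : EuclideanSpace ℝ (Fin n)}
    (h : ∀ t : ℝ, 0 ≤ t → x + t • w ∈ E) :
    w ∈ normalCone (convexHull ℝ (intPoint '' (L.S : Set (Fin n → ℤ)))) {intPoint m} := by
  rw [mem_normalCone_singleton_iff]
  by_cases hw : w = 0
  · simp [hw]
  have hlim : Filter.Tendsto (fun j : ℕ => (j : ℝ)⁻¹ • x + w) Filter.atTop (nhds w) := by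
    have h1 : Filter.Tendsto (fun j : ℕ => (j : ℝ)⁻¹ • x) Filter.atTop (nhds ((0 : ℝ) • x)) :=
      tendsto_inv_atTop_nhds_zero_nat.smul_const x
    simpa using h1.add_const w
  have hnorm : Filter.Tendsto (fun j : ℕ => ‖(j : ℝ)⁻¹ • x + w‖) Filter.atTop (nhds ‖w‖) :=
    hlim.norm
  have hpos : 0 < ‖w‖ := norm_pos_iff.2 hw
  have heq : ∀ᶠ j : ℕ in Filter.atTop, x + (j : ℝ) • w = (j : ℝ) • ((j : ℝ)⁻¹ • x + w) := by
    filter_upwards [Filter.eventually_gt_atTop 0] with j hj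
    rw [smul_add, smul_smul, mul_inv_cancel₀ (by positivity), one_smul]
  have h1 : Filter.Tendsto (fun j : ℕ => ‖x + (j : ℝ) • w‖) Filter.atTop Filter.atTop := by
    refine (tendsto_natCast_atTop_atTop.atTop_mul_pos hpos hnorm).congr' ?_
    filter_upwards [heq] with j hj
    rw [hj, norm_smul, Real.norm_natCast]
  have h2 : Filter.Tendsto (fun j : ℕ => ‖x + (j : ℝ) • w‖⁻¹ • (x + (j : ℝ) • w)) Filter.atTop
      (nhds (‖w‖⁻¹ • w)) := by
    refine ((hnorm.inv₀ hpos.ne').smul hlim).congr' ?_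
    filter_upwards [heq, Filter.eventually_gt_atTop 0] with j hj hj0
    rw [hj, norm_smul, Real.norm_natCast, smul_smul, mul_inv, mul_comm (j : ℝ)⁻¹, mul_assoc,
      inv_mul_cancel₀ (by positivity), mul_one]
  intro a ha
  have h3 := hm.inner_le_of_tendsto hEc (fun j : ℕ => h j (by positivity)) h1 h2 ha
  rw [inner_smul_right, inner_smul_right, mul_le_mul_iff_right₀ (by positivity)] at h3
  exact h3

variable (hEo : IsOpen E)
  (hmax : ∀ T ⊆ L.amoebaCompl, IsPreconnected T → (T ∩ E).Nonempty → T ⊆ E)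

include hEo hmax

theorem IsOrder.add_smul_mem_of_mem_normalCone {w : EuclideanSpace ℝ (Fin n)}
    (hw : w ∈ normalCone (convexHull ℝ (intPoint '' (L.S : Set (Fin n → ℤ)))) {intPoint m})
    {x : EuclideanSpace ℝ (Fin n)} (hx : x ∈ E) {t : ℝ} (ht : 0 ≤ t) : x + t • w ∈ E := by
  rw [mem_normalCone_singleton_iff] at hw
  refine hmax ((fun t : ℝ => x + t • w) '' Set.Ici 0) ?_ ?_ ⟨x, ⟨0, by simp⟩, hx⟩ ⟨t, ht, rfl⟩
  · rintro _ ⟨t, ht, rfl⟩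
    exact hm.add_smul_mem hEc hEo hw hx ht
  · exact isPreconnected_Ici.image _ (by fun_prop)

theorem IsOrder.recessionCone_eq (hne : E.Nonempty) :
    normalCone (convexHull ℝ (intPoint '' (L.S : Set (Fin n → ℤ)))) {intPoint m} =
      recessionCone E := by
  obtain ⟨x, hx⟩ := hne
  ext w
  exact ⟨fun hw x hx t ht => hm.add_smul_mem_of_mem_normalCone hEc hEo hmax hw hx ht,
    fun hw => hm.mem_normalCone_of_ray hEc (hw x hx)⟩

theorem IsOrder.isBounded_iff (hne : E.Nonempty) :
    Bornology.IsBounded E ↔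
      ∀ w ∈ normalCone (convexHull ℝ (intPoint '' (L.S : Set (Fin n → ℤ)))) {intPoint m},
        w = 0 := by
  constructor
  · intro hb w hw
    by_contra hw0
    obtain ⟨x, hx⟩ := hne
    obtain ⟨C, hC⟩ := hb.exists_norm_le
    have h0 : 0 < ‖w‖ := norm_pos_iff.2 hw0
    have hC0 : 0 ≤ C := (norm_nonneg _).trans (hC x hx)
    have h1 := hC _ (hm.add_smul_mem_of_mem_normalCone hEc hEo hmax hw hx
      (t := (C + ‖x‖ + 1) / ‖w‖) (by positivity))
    have h2 := norm_sub_le_norm_add ((((C + ‖x‖ + 1) / ‖w‖) : ℝ) • w) x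
    rw [norm_smul, Real.norm_of_nonneg (by positivity), div_mul_cancel₀ _ h0.ne',
      add_comm _ x] at h2
    linarith
  · intro h
    by_contra hb
    have h1 (j : ℕ) : ∃ x ∈ E, (j : ℝ) < ‖x‖ := by
      by_contra! h2
      exact hb (isBounded_iff_forall_norm_le.2 ⟨j, h2⟩)
    choose x hx hxn using h1
    have hx1 : Filter.Tendsto (fun j => ‖x j‖) Filter.atTop Filter.atTop :=
      Filter.tendsto_atTop_mono (fun j => (hxn j).le) tendsto_natCast_atTop_atTop
    have hsph (j : ℕ) : ‖x j‖⁻¹ • x j ∈ Metric.sphere (0 : EuclideanSpace ℝ (Fin n)) 1 := by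
      have : ‖x j‖ ≠ 0 := ((Nat.cast_nonneg j).trans_lt (hxn j)).ne'
      rw [mem_sphere_zero_iff_norm, norm_smul, norm_inv, norm_norm, inv_mul_cancel₀ this]
    obtain ⟨w, hw, φ, hφ, hlim⟩ := (isCompact_sphere _ _).tendsto_subseq hsph
    have h3 := h w (mem_normalCone_singleton_iff.2 fun a ha =>
      hm.inner_le_of_tendsto hEc (x := x ∘ φ) (fun j => hx _) (hx1.comp hφ.tendsto_atTop) hlim ha)
    rw [h3] at hw
    simp at hw

end Order

end LaurentFamily

/-! ### The Laurent coefficients of a regular function -/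

/-- The character `z ↦ z ^ a` of the torus. -/
noncomputable def torusChar {n : ℕ} (a : Fin n → ℤ) : (Fin n → ℂˣ) →* ℂ where
  toFun z := ∏ i, (z i : ℂ) ^ a i
  map_one' := by simp
  map_mul' z w := by simp [mul_zpow, Finset.prod_mul_distrib]

theorem torusChar_apply {n : ℕ} (a : Fin n → ℤ) (z : Fin n → ℂˣ) :
    torusChar a z = ∏ i, (z i : ℂ) ^ a i := rfl

theorem torusChar_injective {n : ℕ} : Function.Injective (torusChar (n := n)) := by
  intro a b h
  ext i
  have h1 := DFunLike.congr_fun h (Function.update (1 : Fin n → ℂˣ) i (Units.mk0 2 two_ne_zero))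
  have h2 (c : Fin n → ℤ) :
      torusChar c (Function.update (1 : Fin n → ℂˣ) i (Units.mk0 2 two_ne_zero)) = 2 ^ c i := by
    rw [torusChar_apply, Finset.prod_eq_single i]
    · simp
    · intro j _ hj
      simp [Function.update_of_ne hj]
    · simp
  rw [h2, h2] at h1
  have h3 := congrArg norm h1
  rw [norm_zpow, norm_zpow, Complex.norm_ofNat] at h3
  exact zpow_right_injective₀ (by norm_num) (by norm_num) h3

theorem laurentEval_injective {n : ℕ} : Function.Injective (laurentEval (n := n)) := by
  have h := (linearIndependent_monoidHom (Fin n → ℂˣ) ℂ).comp _ torusChar_injective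
  intro c d hcd
  refine h ?_
  ext z
  have h1 (c : (Fin n → ℤ) →₀ ℂ) : Finsupp.linearCombination ℂ
      ((fun χ : (Fin n → ℂˣ) →* ℂ => (χ : (Fin n → ℂˣ) → ℂ)) ∘ torusChar) c z =
        laurentEval c z := by
    simp [Finsupp.linearCombination_apply, laurentEval, Finsupp.sum, torusChar_apply]
  rw [h1, h1, hcd]

theorem laurentCoeff_eq {n : ℕ} {g : (Fin n → ℂˣ) → ℂ} {c : (Fin n → ℤ) →₀ ℂ}
    (h : ∀ z, g z = laurentEval c z) : laurentCoeff g = c := by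
  have hex : ∃ c : (Fin n → ℤ) →₀ ℂ, ∀ z, g z = laurentEval c z := ⟨c, h⟩
  rw [laurentCoeff, dif_pos hex]
  refine laurentEval_injective (funext fun z => ?_)
  rw [← hex.choose_spec z, h z]

theorem laurentCoeff_eq_of_sum {n : ℕ} {g : (Fin n → ℂˣ) → ℂ} (T : Finset (Fin n → ℤ))
    (c : (Fin n → ℤ) → ℂ) (hc : ∀ a ∉ T, c a = 0)
    (h : ∀ z, g z = ∑ a ∈ T, c a * ∏ i, (z i : ℂ) ^ a i) (a : Fin n → ℤ) :
    laurentCoeff g a = c a := by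
  rw [laurentCoeff_eq (c := Finsupp.onFinset T c fun a ha => by
    by_contra h'
    exact ha (hc a h'))]
  · rfl
  · intro z
    rw [h, laurentEval, Finsupp.onFinset_sum _ (by simp)]

/-- The coefficients `Q_m(A, B)` are, up to powers of `det A` and `det B`, finitely many polynomials
in the entries of `A` and `B⁻¹`. -/
theorem exists_Q_eq {n : ℕ} {f : GL (Fin n) ℂ → ℂ} (hf : IsRegularFunction f) :
    ∃ (N : ℤ) (T : Finset (Fin n → ℤ))
      (r : (Fin n → ℤ) → MvPolynomial ((Fin n × Fin n) ⊕ (Fin n × Fin n)) ℂ),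
      (∀ a A B, Q f a A B = (A : Matrix (Fin n) (Fin n) ℂ).det ^ N *
        (B⁻¹ : GL (Fin n) ℂ).val.det ^ N *
        MvPolynomial.eval (Sum.elim (fun ij => A.val ij.1 ij.2)
          fun ij => (B⁻¹ : GL (Fin n) ℂ).val ij.1 ij.2) (r a)) ∧
      (∀ a ∉ T, ∀ A B, Q f a A B = 0) ∧
      ∀ A B z, f (A * diagGL z * B⁻¹) = ∑ a ∈ T, Q f a A B * ∏ i, (z i : ℂ) ^ a i := by
  classical
  obtain ⟨N, p, hp⟩ := hf
  -- the polynomial `p` of a generic product `A diag(z) C`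
  let P : MvPolynomial (Fin n) (MvPolynomial ((Fin n × Fin n) ⊕ (Fin n × Fin n)) ℂ) :=
    MvPolynomial.aeval (fun ij : Fin n × Fin n =>
    ∑ k, MvPolynomial.C (MvPolynomial.X (Sum.inl (ij.1, k)) * MvPolynomial.X (Sum.inr (k, ij.2))) *
      MvPolynomial.X k) p
  let ι : (Fin n →₀ ℕ) → Fin n → ℤ := fun s i => s i + N
  have hι : Function.Injective ι := fun s t h => by
    ext i
    have := congrFun h i
    simp only [ι, add_left_inj] at this
    exact_mod_cast this
  let T := P.support.image ι
  let r : (Fin n → ℤ) → MvPolynomial ((Fin n × Fin n) ⊕ (Fin n × Fin n)) ℂ := fun a =>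
    if a ∈ T then P.coeff (Function.invFun ι a) else 0
  let c : GL (Fin n) ℂ → GL (Fin n) ℂ → (Fin n → ℤ) → ℂ := fun A B a =>
    A.val.det ^ N * (B⁻¹ : GL (Fin n) ℂ).val.det ^ N *
        MvPolynomial.eval (Sum.elim (fun ij => A.val ij.1 ij.2)
          fun ij => (B⁻¹ : GL (Fin n) ℂ).val ij.1 ij.2) (r a)
  have hc0 (A B : GL (Fin n) ℂ) : ∀ a ∉ T, c A B a = 0 := fun a ha => by
    simp only [c, r, if_neg ha, map_zero, mul_zero]
  have hsum (A B : GL (Fin n) ℂ) (z : Fin n → ℂˣ) :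
      f (A * diagGL z * B⁻¹) = ∑ a ∈ T, c A B a * ∏ i, (z i : ℂ) ^ a i := by
    have h1 : ((A * diagGL z * B⁻¹ : GL (Fin n) ℂ) : Matrix (Fin n) (Fin n) ℂ) =
      A.val * Matrix.diagonal (fun i => (z i : ℂ)) * (B⁻¹ : GL (Fin n) ℂ).val := rfl
    let φ : MvPolynomial (Fin n) (MvPolynomial ((Fin n × Fin n) ⊕ (Fin n × Fin n)) ℂ) →+* ℂ :=
      MvPolynomial.eval₂Hom
      (MvPolynomial.eval (Sum.elim (fun ij => A.val ij.1 ij.2)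
          fun ij => (B⁻¹ : GL (Fin n) ℂ).val ij.1 ij.2)) (fun i => (z i : ℂ))
    have h2 : MvPolynomial.eval (fun ij : Fin n × Fin n =>
        (A * diagGL z * B⁻¹ : GL (Fin n) ℂ).val ij.1 ij.2) p = φ P := by
      rw [MvPolynomial.map_aeval]
      have h3 : φ.comp (algebraMap ℂ (MvPolynomial (Fin n)
          (MvPolynomial ((Fin n × Fin n) ⊕ (Fin n × Fin n)) ℂ))) = RingHom.id ℂ := by
        ext w
        rw [RingHom.comp_apply, MvPolynomial.algebraMap_apply, MvPolynomial.algebraMap_eq]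
        simp [φ]
      rw [h3]
      refine congrArg (fun g => MvPolynomial.eval g p) (funext fun ij => ?_)
      rw [h1, Matrix.mul_apply]
      simp only [Matrix.mul_diagonal, φ, map_sum, map_mul, MvPolynomial.coe_eval₂Hom,
        MvPolynomial.eval₂_C, MvPolynomial.eval₂_X, MvPolynomial.eval_X, Sum.elim_inl, Sum.elim_inr]
      exact Finset.sum_congr rfl fun k _ => by ring
    have h4 : φ P = ∑ s ∈ P.support, MvPolynomial.eval (Sum.elim (fun ij => A.val ij.1 ij.2)
          fun ij => (B⁻¹ : GL (Fin n) ℂ).val ij.1 ij.2) (P.coeff s) * ∏ i, (z i : ℂ) ^ s i := by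
      simp only [φ, MvPolynomial.coe_eval₂Hom]
      exact MvPolynomial.eval₂_eq' _ _ _
    rw [hp, h2, h4, h1, Matrix.det_mul, Matrix.det_mul, Matrix.det_diagonal,
      Finset.sum_image hι.injOn, Finset.mul_sum]
    refine Finset.sum_congr rfl fun s hs => ?_
    have h5 : r (ι s) = P.coeff s := by
      simp only [r, if_pos (show ι s ∈ T from Finset.mem_image_of_mem _ hs),
        Function.leftInverse_invFun hι s]
    have h6 : ∏ i, (z i : ℂ) ^ ι s i = (∏ i, (z i : ℂ)) ^ N * ∏ i, (z i : ℂ) ^ s i := by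
      rw [← Finset.prod_zpow, ← Finset.prod_mul_distrib]
      refine Finset.prod_congr rfl fun i _ => ?_
      rw [zpow_add₀ (z i).ne_zero, zpow_natCast, mul_comm]
    simp only [c, h5, h6, mul_zpow]
    ring
  have hQ (a A B) : Q f a A B = c A B a :=
    laurentCoeff_eq_of_sum T _ (hc0 A B) (hsum A B) a
  refine ⟨N, T, r, hQ, fun a ha A B => (hQ a A B).trans (hc0 A B a ha), fun A B z => ?_⟩
  simp only [hQ]
  exact hsum A B z

theorem Q_mul_diagGL {n : ℕ} {f : GL (Fin n) ℂ → ℂ} (hf : IsRegularFunction f) (a : Fin n → ℤ)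
    (A B : GL (Fin n) ℂ) (w : Fin n → ℂˣ) :
    Q f a (A * diagGL w) B = Q f a A B * ∏ i, (w i : ℂ) ^ a i := by
  obtain ⟨N, T, r, -, h0, h⟩ := exists_Q_eq hf
  refine laurentCoeff_eq_of_sum T (fun a => Q f a A B * ∏ i, (w i : ℂ) ^ a i)
    (fun a ha => by simp only [h0 a ha, zero_mul]) (fun z => ?_) a
  have h1 : diagGL w * diagGL z = diagGL (w * z) := by
    refine Units.ext ?_
    simp [diagGL, Matrix.diagonal_mul_diagonal]
  rw [Psi, mul_assoc A, h1, h]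
  refine Finset.sum_congr rfl fun a _ => ?_
  simp [mul_zpow, Finset.prod_mul_distrib, mul_assoc]

/-! ### The unitary group -/

instance unitarySecondCountable (n : ℕ) :
    SecondCountableTopology (Matrix.unitaryGroup (Fin n) ℂ) := by
  have : SecondCountableTopology (Matrix (Fin n) (Fin n) ℂ) :=
    inferInstanceAs (SecondCountableTopology (Fin n → Fin n → ℂ))
  exact TopologicalSpace.Subtype.secondCountableTopology _

instance haarU_isProbabilityMeasure (n : ℕ) : IsProbabilityMeasure (haarU n) :=
  ⟨Measure.haarMeasure_self⟩

instance haarU_isHaarMeasure (n : ℕ) : (haarU n).IsHaarMeasure :=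
  Measure.isHaarMeasure_haarMeasure _

instance haarU_isMulRightInvariant (n : ℕ) : (haarU n).IsMulRightInvariant where
  map_mul_right_eq_self g := by
    have h1 : IsProbabilityMeasure ((haarU n).map (· * g)) :=
      Measure.isProbabilityMeasure_map (measurable_mul_const g).aemeasurable
    have h2 : ((haarU n).map (· * g)).IsHaarMeasure := inferInstance
    exact Measure.isHaarMeasure_eq_of_isProbabilityMeasure _ _

theorem infinite_unit_circle : (Metric.sphere (0 : ℂ) 1).Infinite := by
  refine IsPreconnected.infinite_of_nontrivial
    (isPreconnected_sphere (by rw [Complex.rank_real_complex]; norm_num) _ _) ?_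
  exact ⟨1, by simp, -1, by simp, by norm_num⟩

open scoped Matrix.Norms.L2Operator in
/-- The unitary group is connected: a unitary matrix `U` is at distance less than `2` from any
scalar `c` of modulus one such that `-c` is not an eigenvalue of `U`, and such matrices are joined
by a path. -/
instance unitaryConnected (n : ℕ) : ConnectedSpace (Matrix.unitaryGroup (Fin n) ℂ) := by
  have hj (U : Matrix.unitaryGroup (Fin n) ℂ) : Joined 1 U := by
    have hfin := (Matrix.finite_spectrum (U : Matrix (Fin n) (Fin n) ℂ)).union
      (Matrix.finite_spectrum (1 : Matrix (Fin n) (Fin n) ℂ))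
    obtain ⟨c', hc', hcU⟩ := infinite_unit_circle.exists_notMem_finite hfin
    rw [Set.mem_union, not_or] at hcU
    have hc1 : ‖c'‖ = 1 := by simpa using hc'
    have hc0 : c' ≠ 0 := norm_ne_zero_iff.1 (by rw [hc1]; exact one_ne_zero)
    set r : ℂˣ := Units.mk0 (-c')⁻¹ (inv_ne_zero (neg_ne_zero.2 hc0)) with hr
    have hrc : (r : ℂ) * -c' = 1 := inv_mul_cancel₀ (neg_ne_zero.2 hc0)
    have hrr : star (r : ℂ) * r = 1 := by
      rw [Complex.star_def, ← Complex.normSq_eq_conj_mul_self, Complex.normSq_eq_norm_sq]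
      simp [hr, hc1]
    have hun (W : Matrix.unitaryGroup (Fin n) ℂ) :
        (r : ℂ) • (W : Matrix (Fin n) (Fin n) ℂ) ∈ Matrix.unitaryGroup (Fin n) ℂ := by
      rw [Matrix.mem_unitaryGroup_iff', star_smul, smul_mul_smul_comm, hrr, one_smul]
      exact Matrix.mem_unitaryGroup_iff'.1 W.2
    have hnorm (W : Matrix.unitaryGroup (Fin n) ℂ)
        (hW : c' ∉ spectrum ℂ (W : Matrix (Fin n) (Fin n) ℂ)) :
        ‖(r : ℂ) • (W : Matrix (Fin n) (Fin n) ℂ) - 1‖ < 2 := by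
      rw [Unitary.norm_sub_one_lt_two_iff (hun W)]
      intro h
      refine hW ((spectrum.smul_mem_smul_iff (r := r)).1 ?_)
      have h' : r • c' = -1 := by
        rw [Units.smul_def, smul_eq_mul]
        linear_combination -hrc
      rw [h']
      exact h
    have hr1 : ‖(r : ℂ)‖ = 1 := by simp [hr, hc1]
    let V : Matrix.unitaryGroup (Fin n) ℂ := star ⟨_, hun 1⟩
    have hV : (r : ℂ) • (V : Matrix (Fin n) (Fin n) ℂ) = 1 := by
      change (r : ℂ) • star ((r : ℂ) • (1 : Matrix (Fin n) (Fin n) ℂ)) = 1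
      rw [star_smul, star_one, smul_smul, mul_comm, hrr, one_smul]
    have hsub (W : Matrix.unitaryGroup (Fin n) ℂ)
        (hW : c' ∉ spectrum ℂ (W : Matrix (Fin n) (Fin n) ℂ)) : Joined V W := by
      refine Unitary.joined V W ?_
      have h := hnorm W hW
      rwa [← hV, ← smul_sub, norm_smul, hr1, one_mul] at h
    exact (hsub 1 hcU.2).symm.trans (hsub U hcU.1)
  have : PathConnectedSpace (Matrix.unitaryGroup (Fin n) ℂ) :=
    ⟨⟨1⟩, fun U V => (hj U).symm.trans (hj V)⟩
  infer_instance

/-! ### Singular values and the matrix amoeba -/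

theorem exists_perm_of_map_univ_eq {ι α : Type*} [Fintype ι] {f g : ι → α}
    (h : Finset.univ.val.map f = Finset.univ.val.map g) :
    ∃ σ : Equiv.Perm ι, ∀ i, f i = g (σ i) := by
  classical
  have hcard (c : α) : Fintype.card {i // f i = c} = Fintype.card {i // g i = c} := by
    have h1 := congrArg (Multiset.count c) h
    rw [Multiset.count_map, Multiset.count_map] at h1
    simp only [eq_comm (a := c)] at h1
    rw [Fintype.card_subtype, Fintype.card_subtype]
    exact h1
  exact ⟨Equiv.ofFiberEquiv fun c => Fintype.equivOfCardEq (hcard c),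
    fun i => (Equiv.ofFiberEquiv_map _ i).symm⟩

theorem unitaryToGL_star {n : ℕ} (V : Matrix.unitaryGroup (Fin n) ℂ) :
    unitaryToGL (star V) = (unitaryToGL V)⁻¹ := by
  rw [eq_inv_iff_mul_eq_one]
  refine Units.ext ?_
  change (star V : Matrix (Fin n) (Fin n) ℂ) * V = 1
  exact Matrix.mem_unitaryGroup_iff'.1 V.2

theorem coe_expDiag {n : ℕ} (x : EuclideanSpace ℝ (Fin n)) :
    ((expDiag x : GL (Fin n) ℂ) : Matrix (Fin n) (Fin n) ℂ) =
      Matrix.diagonal fun i => Complex.exp (x i) := rfl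

theorem coe_unitary_mul_expDiag {n : ℕ} (U V : Matrix.unitaryGroup (Fin n) ℂ)
    (x : EuclideanSpace ℝ (Fin n)) :
    ((unitaryToGL U * expDiag x * unitaryToGL (star V) : GL (Fin n) ℂ) : Matrix (Fin n) (Fin n) ℂ) =
      U.1 * Matrix.diagonal (fun i => Complex.exp (x i)) * V.1.conjTranspose := rfl

theorem charpoly_adjoint_comp_self {n : ℕ} (A : Matrix (Fin n) (Fin n) ℂ) :
    (LinearMap.adjoint (Matrix.toEuclideanLin A) ∘ₗ Matrix.toEuclideanLin A).charpoly =
      (A.conjTranspose * A).charpoly := by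
  have h1 : LinearMap.adjoint (Matrix.toEuclideanLin A) ∘ₗ Matrix.toEuclideanLin A =
      Matrix.toLin (EuclideanSpace.basisFun (Fin n) ℂ).toBasis
        (EuclideanSpace.basisFun (Fin n) ℂ).toBasis (A.conjTranspose * A) := by
    rw [← Matrix.toEuclideanLin_conjTranspose_eq_adjoint,
      Matrix.toLin_mul _ (EuclideanSpace.basisFun (Fin n) ℂ).toBasis]
    rfl
  rw [h1, ← LinearMap.charpoly_toMatrix _ (EuclideanSpace.basisFun (Fin n) ℂ).toBasis,
    LinearMap.toMatrix_toLin]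

theorem charpoly_conjTranspose_mul_self {n : ℕ} {U V : Matrix (Fin n) (Fin n) ℂ}
    (hU : U.conjTranspose * U = 1) (hV : V.conjTranspose * V = 1) (x : Fin n → ℝ) :
    ((U * Matrix.diagonal (fun i => Complex.exp (x i)) * V.conjTranspose).conjTranspose *
      (U * Matrix.diagonal (fun i => Complex.exp (x i)) * V.conjTranspose)).charpoly =
      ∏ i, (Polynomial.X - Polynomial.C ((Real.exp (x i) ^ 2 : ℝ) : ℂ)) := by
  have hD : (Matrix.diagonal fun i => Complex.exp (x i)).conjTranspose *
      (Matrix.diagonal fun i => Complex.exp (x i)) =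
        Matrix.diagonal fun i => ((Real.exp (x i) ^ 2 : ℝ) : ℂ) := by
    rw [Matrix.diagonal_conjTranspose, Matrix.diagonal_mul_diagonal]
    congr 1
    ext i
    rw [Pi.star_apply, Complex.star_def, ← Complex.exp_conj, Complex.conj_ofReal, sq]
    push_cast
    rfl
  set D := Matrix.diagonal fun i => Complex.exp (x i)
  have h2 : (U * D * V.conjTranspose).conjTranspose * (U * D * V.conjTranspose) =
      V * (D.conjTranspose * D * V.conjTranspose) := by
    rw [Matrix.conjTranspose_mul, Matrix.conjTranspose_mul, Matrix.conjTranspose_conjTranspose]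
    simp only [Matrix.mul_assoc]
    rw [← Matrix.mul_assoc _ U, hU, Matrix.one_mul]
  rw [h2, Matrix.charpoly_mul_comm, Matrix.mul_assoc, hV, Matrix.mul_one, hD,
    Matrix.charpoly_diagonal]

/-- The logarithmic singular values of `U exp(diag(x)) V*` are the coordinates of `x`. -/
theorem exists_perm_sLog {n : ℕ} (U V : Matrix.unitaryGroup (Fin n) ℂ)
    (x : EuclideanSpace ℝ (Fin n)) :
    ∃ σ : Equiv.Perm (Fin n), ∀ i,
      x i = sLog (unitaryToGL U * expDiag x * unitaryToGL (star V)) (σ i) := by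
  set T := Matrix.toEuclideanLin
      (unitaryToGL U * expDiag x * unitaryToGL (star V) : GL (Fin n) ℂ).val with hT
  have hn : Module.finrank ℂ (EuclideanSpace ℂ (Fin n)) = n := finrank_euclideanSpace_fin
  have h1 := T.isSymmetric_adjoint_comp_self.roots_charpoly_eq_eigenvalues hn
  have h2 : (LinearMap.adjoint T ∘ₗ T).charpoly =
      ∏ i, (Polynomial.X - Polynomial.C ((Real.exp (x i) ^ 2 : ℝ) : ℂ)) := by
    rw [hT, charpoly_adjoint_comp_self, coe_unitary_mul_expDiag]
    exact charpoly_conjTranspose_mul_self (Matrix.mem_unitaryGroup_iff'.1 U.2)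
      (Matrix.mem_unitaryGroup_iff'.1 V.2) _
  rw [h2, Polynomial.roots_prod _ _
    (Finset.prod_ne_zero_iff.2 fun i _ => Polynomial.X_sub_C_ne_zero _)] at h1
  simp only [Polynomial.roots_X_sub_C, Multiset.bind_singleton] at h1
  obtain ⟨σ, hσ⟩ := exists_perm_of_map_univ_eq h1
  refine ⟨σ, fun i => ?_⟩
  have h3 : Real.exp (x i) ^ 2 = T.isSymmetric_adjoint_comp_self.eigenvalues hn (σ i) := by
    have := hσ i
    simp only [Function.comp_apply, Complex.coe_algebraMap] at this
    exact_mod_cast this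
  change x i = Real.log (T.singularValues (σ i : ℕ))
  rw [T.singularValues_fin hn, ← h3, Real.sqrt_sq (Real.exp_pos _).le, Real.log_exp]

/-- The singular value decomposition of an invertible matrix, with the singular values in a
prescribed order. -/
theorem exists_eq_unitary_mul_expDiag {n : ℕ} (A : GL (Fin n) ℂ) (σ : Equiv.Perm (Fin n))
    {x : EuclideanSpace ℝ (Fin n)} (hx : ∀ i, x i = sLog A (σ i)) :
    ∃ U V : Matrix.unitaryGroup (Fin n) ℂ,
      A = unitaryToGL U * expDiag x * unitaryToGL (star V) := by
  set T := Matrix.toEuclideanLin A.val with hT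
  have hn : Module.finrank ℂ (EuclideanSpace ℂ (Fin n)) = n := finrank_euclideanSpace_fin
  set hS := T.isSymmetric_adjoint_comp_self
  let b := hS.eigenvectorBasis hn
  have hinj : Function.Injective T := by
    intro y z hyz
    have h1 : A.val.mulVec y.ofLp = A.val.mulVec z.ofLp := congrArg WithLp.ofLp hyz
    have h2 := congrArg (A⁻¹.val.mulVec) h1
    rw [Matrix.mulVec_mulVec, Matrix.mulVec_mulVec, ← Units.val_mul, inv_mul_cancel,
      Units.val_one, Matrix.one_mulVec, Matrix.one_mulVec] at h2
    exact WithLp.ofLp_injective 2 h2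
  have hpos (i : Fin n) : 0 < T.singularValues i :=
    T.injective_iff_forall_lt_finrank_singularValues_pos.1 hinj i (by rw [hn]; exact i.2)
  have hexp (i : Fin n) : Real.exp (x i) = T.singularValues (σ i : Fin n) := by
    rw [hx i]
    exact Real.exp_log (hpos _)
  have horth (i j : Fin n) : inner ℂ (T (b (σ i))) (T (b (σ j))) =
      if i = j then ((Real.exp (x i) ^ 2 : ℝ) : ℂ) else 0 := by
    rw [← LinearMap.adjoint_inner_right]
    have h1 : (LinearMap.adjoint T) (T (b (σ j))) = (hS.eigenvalues hn (σ j) : ℂ) • b (σ j) :=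
      hS.apply_eigenvectorBasis hn (σ j)
    rw [h1, inner_smul_right, b.inner_eq_ite, hexp, T.sq_singularValues_fin hn]
    by_cases h : i = j
    · simp [h]
    · simp [h]
  let V : Matrix.unitaryGroup (Fin n) ℂ := ⟨Matrix.of fun k j => b (σ j) k, by
    rw [Matrix.mem_unitaryGroup_iff']
    ext i j
    have h1 := b.inner_eq_ite (σ i) (σ j)
    rw [PiLp.inner_apply] at h1
    simp only [RCLike.inner_apply, EmbeddingLike.apply_eq_iff_eq] at h1
    rw [Matrix.mul_apply, Matrix.one_apply, ← h1]
    exact Finset.sum_congr rfl fun k _ => by simp [Matrix.star_apply, mul_comm]⟩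
  let U : Matrix.unitaryGroup (Fin n) ℂ :=
    ⟨Matrix.of fun k j => T (b (σ j)) k * ((Real.exp (x j))⁻¹ : ℝ), by
    rw [Matrix.mem_unitaryGroup_iff']
    ext i j
    have h1 := horth i j
    rw [PiLp.inner_apply] at h1
    simp only [RCLike.inner_apply] at h1
    rw [Matrix.mul_apply, Matrix.one_apply]
    have h2 : ∑ k,
        (star (Matrix.of fun k j => T (b (σ j)) k * (((Real.exp (x j))⁻¹ : ℝ) : ℂ))) i k *
        (Matrix.of fun k j => T (b (σ j)) k * (((Real.exp (x j))⁻¹ : ℝ) : ℂ)) k j =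
        (((Real.exp (x i))⁻¹ * (Real.exp (x j))⁻¹ : ℝ) : ℂ) *
          if i = j then ((Real.exp (x i) ^ 2 : ℝ) : ℂ) else 0 := by
      rw [← h1, Finset.mul_sum]
      refine Finset.sum_congr rfl fun k _ => ?_
      rw [Matrix.star_apply, Matrix.of_apply, Matrix.of_apply, star_mul', Complex.star_def,
        Complex.conj_ofReal]
      push_cast
      ring
    rw [h2]
    by_cases h : i = j
    · subst h
      rw [if_pos rfl, if_pos rfl, ← Complex.ofReal_mul]
      have := (Real.exp_pos (x i)).ne'
      rw [show (Real.exp (x i))⁻¹ * (Real.exp (x i))⁻¹ * Real.exp (x i) ^ 2 = 1 by field_simp]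
      simp
    · rw [if_neg h, if_neg h, mul_zero]⟩
  refine ⟨U, V, ?_⟩
  rw [unitaryToGL_star, eq_mul_inv_iff_mul_eq]
  refine Units.ext ?_
  ext k j
  rw [Units.val_mul, Units.val_mul, coe_expDiag, Matrix.mul_diagonal]
  change (A.val * Matrix.of fun k j => b (σ j) k) k j =
    T (b (σ j)) k * ((Real.exp (x j))⁻¹ : ℝ) * Complex.exp (x j)
  rw [mul_assoc, ← Complex.ofReal_exp, ← Complex.ofReal_mul,
    inv_mul_cancel₀ (Real.exp_pos _).ne', Complex.ofReal_one, mul_one]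
  rfl

theorem mem_amoeba_iff {n : ℕ} {f : GL (Fin n) ℂ → ℂ} {x : EuclideanSpace ℝ (Fin n)} :
    x ∈ amoeba f ↔ ∃ U V : Matrix.unitaryGroup (Fin n) ℂ,
      f (unitaryToGL U * expDiag x * unitaryToGL (star V)) = 0 := by
  constructor
  · rintro ⟨A, hA, σ, hσ⟩
    obtain ⟨U, V, h⟩ := exists_eq_unitary_mul_expDiag A σ hσ
    exact ⟨U, V, h ▸ hA⟩
  · rintro ⟨U, V, h⟩
    obtain ⟨σ, hσ⟩ := exists_perm_sLog U V x
    exact ⟨_, h, σ, hσ⟩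

/-- The unitary group is Zariski dense in the general linear group: by the singular value
decomposition this reduces to the density of the compact torus in the complex torus. -/
theorem eval_eq_zero_of_unitary {n : ℕ} {r : MvPolynomial (Fin n × Fin n) ℂ}
    (h : ∀ M ∈ Matrix.unitaryGroup (Fin n) ℂ, MvPolynomial.eval (fun ij => M ij.1 ij.2) r = 0)
    (A : GL (Fin n) ℂ) : MvPolynomial.eval (fun ij => A.val ij.1 ij.2) r = 0 := by
  obtain ⟨⟨U, hU⟩, ⟨V, hV⟩, hA⟩ := exists_eq_unitary_mul_expDiag A 1 (x := sLog A) fun _ => rfl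
  let P : MvPolynomial (Fin n) ℂ := MvPolynomial.aeval (fun ij : Fin n × Fin n =>
    ∑ k, MvPolynomial.C (U ij.1 k * V.conjTranspose k ij.2) * MvPolynomial.X k) r
  have hP (z : Fin n → ℂ) : MvPolynomial.eval z P = MvPolynomial.eval (fun ij =>
      (U * Matrix.diagonal z * V.conjTranspose) ij.1 ij.2) r := by
    rw [MvPolynomial.map_aeval]
    have h3 : (MvPolynomial.eval z).comp (algebraMap ℂ (MvPolynomial (Fin n) ℂ)) =
        RingHom.id ℂ := by
      ext w
      rw [RingHom.comp_apply, MvPolynomial.algebraMap_eq]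
      simp
    rw [h3]
    refine congrArg (fun g => MvPolynomial.eval g r) (funext fun ij => ?_)
    rw [Matrix.mul_apply]
    simp only [Matrix.mul_diagonal, map_sum, map_mul, MvPolynomial.eval_C, MvPolynomial.eval_X]
    exact Finset.sum_congr rfl fun k _ => by ring
  have hP0 : P = 0 := by
    refine MvPolynomial.funext_set (fun _ => Metric.sphere (0 : ℂ) 1)
      (fun _ => infinite_unit_circle) fun z hz => ?_
    have hz1 (i : Fin n) : ‖z i‖ = 1 := by simpa using hz i trivial
    have hD : Matrix.diagonal z ∈ Matrix.unitaryGroup (Fin n) ℂ := by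
      rw [Matrix.mem_unitaryGroup_iff', Matrix.star_eq_conjTranspose,
        Matrix.diagonal_conjTranspose, Matrix.diagonal_mul_diagonal, ← Matrix.diagonal_one]
      congr 1
      ext i
      rw [Pi.star_apply, Complex.star_def, ← Complex.normSq_eq_conj_mul_self,
        Complex.normSq_eq_norm_sq, hz1 i]
      simp
    rw [hP, map_zero]
    exact h _ (mul_mem (mul_mem hU hD) (Unitary.star_mem hV))
  have h1 := hP fun i => Complex.exp (sLog A i)
  rw [hP0, map_zero] at h1
  have h2 : A.val = U * Matrix.diagonal (fun i => Complex.exp (sLog A i)) * V.conjTranspose :=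
    (congrArg Units.val hA).trans (coe_unitary_mul_expDiag _ _ _)
  rw [h1, ← h2]

theorem exists_unitary_Q_ne_zero {n : ℕ} {f : GL (Fin n) ℂ → ℂ} (hf : IsRegularFunction f)
    {a : Fin n → ℤ} (ha : a ∈ support f) :
    ∃ U V : Matrix.unitaryGroup (Fin n) ℂ, Q f a (unitaryToGL U) (unitaryToGL V) ≠ 0 := by
  obtain ⟨N, T, r, hQ, -, -⟩ := exists_Q_eq hf
  by_contra! h0
  obtain ⟨A, B, hAB⟩ := ha
  refine hAB ?_
  have hdet (A : GL (Fin n) ℂ) : A.val.det ^ N ≠ 0 :=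
    zpow_ne_zero _ ((Matrix.isUnit_iff_isUnit_det _).1 A.isUnit).ne_zero
  have h1 (U V : Matrix.unitaryGroup (Fin n) ℂ) : MvPolynomial.eval
      (Sum.elim (fun ij => (U : Matrix (Fin n) (Fin n) ℂ) ij.1 ij.2)
        fun ij => (V : Matrix (Fin n) (Fin n) ℂ) ij.1 ij.2) (r a) = 0 := by
    have h2 := h0 U (star V)
    rw [hQ, ← unitaryToGL_star, star_star] at h2
    exact (mul_eq_zero.1 h2).resolve_left (mul_ne_zero (hdet _) (hdet _))
  have h2 (A : GL (Fin n) ℂ) (V : Matrix.unitaryGroup (Fin n) ℂ) : MvPolynomial.eval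
      (Sum.elim (fun ij => A.val ij.1 ij.2)
        fun ij => (V : Matrix (Fin n) (Fin n) ℂ) ij.1 ij.2) (r a) = 0 := by
    have h3 (c : Fin n × Fin n → ℂ) : MvPolynomial.eval c (MvPolynomial.aeval
        (Sum.elim MvPolynomial.X fun ij =>
          MvPolynomial.C ((V : Matrix (Fin n) (Fin n) ℂ) ij.1 ij.2))
        (r a)) = MvPolynomial.eval (Sum.elim c
          fun ij => (V : Matrix (Fin n) (Fin n) ℂ) ij.1 ij.2) (r a) := by
      rw [MvPolynomial.map_aeval]
      have h4 : (MvPolynomial.eval c).comp (algebraMap ℂ (MvPolynomial (Fin n × Fin n) ℂ)) =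
          RingHom.id ℂ := by
        ext w
        rw [RingHom.comp_apply, MvPolynomial.algebraMap_eq]
        simp
      rw [h4]
      refine congrArg (fun g => MvPolynomial.eval g (r a)) (funext fun s => ?_)
      cases s <;> simp
    rw [← h3]
    exact eval_eq_zero_of_unitary (fun U hU => by rw [h3]; exact h1 ⟨U, hU⟩ V) A
  have h5 (A B : GL (Fin n) ℂ) : MvPolynomial.eval
      (Sum.elim (fun ij => A.val ij.1 ij.2) fun ij => B.val ij.1 ij.2) (r a) = 0 := by
    have h3 (c : Fin n × Fin n → ℂ) : MvPolynomial.eval c (MvPolynomial.aeval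
        (Sum.elim (fun ij => MvPolynomial.C (A.val ij.1 ij.2)) MvPolynomial.X)
        (r a)) = MvPolynomial.eval (Sum.elim (fun ij => A.val ij.1 ij.2) c) (r a) := by
      rw [MvPolynomial.map_aeval]
      have h4 : (MvPolynomial.eval c).comp (algebraMap ℂ (MvPolynomial (Fin n × Fin n) ℂ)) =
          RingHom.id ℂ := by
        ext w
        rw [RingHom.comp_apply, MvPolynomial.algebraMap_eq]
        simp
      rw [h4]
      refine congrArg (fun g => MvPolynomial.eval g (r a)) (funext fun s => ?_)
      cases s <;> simp
    rw [← h3]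
    exact eval_eq_zero_of_unitary (fun V hV => by rw [h3]; exact h2 A ⟨V, hV⟩) B
  rw [hQ, h5, mul_zero]

/-! ### The family of Laurent polynomials of a regular function -/

theorem finite_support {n : ℕ} {f : GL (Fin n) ℂ → ℂ} (hf : IsRegularFunction f) :
    (support f).Finite := by
  obtain ⟨N, T, r, -, h0, -⟩ := exists_Q_eq hf
  refine T.finite_toSet.subset ?_
  rintro a ⟨A, B, hAB⟩
  by_contra ha
  exact hAB (h0 a ha A B)

theorem apply_mul_diagGL_mul_inv {n : ℕ} {f : GL (Fin n) ℂ → ℂ} (hf : IsRegularFunction f)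
    (A B : GL (Fin n) ℂ) (z : Fin n → ℂˣ) :
    f (A * diagGL z * B⁻¹) =
      ∑ a ∈ (finite_support hf).toFinset, Q f a A B * ∏ i, (z i : ℂ) ^ a i := by
  obtain ⟨N, T, r, -, h0, h⟩ := exists_Q_eq hf
  rw [h]
  symm
  refine Finset.sum_subset (fun a ha => ?_) fun a _ ha => ?_
  · obtain ⟨A, B, hAB⟩ := (finite_support hf).mem_toFinset.1 ha
    by_contra h'
    exact hAB (h0 a h' A B)
  · rw [Set.Finite.mem_toFinset] at ha
    have : Q f a A B = 0 := by
      by_contra h'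
      exact ha ⟨A, B, h'⟩
    rw [this, zero_mul]

theorem continuous_Q_unitary {n : ℕ} {f : GL (Fin n) ℂ → ℂ} (hf : IsRegularFunction f)
    (a : Fin n → ℤ) :
    Continuous fun k : Matrix.unitaryGroup (Fin n) ℂ × Matrix.unitaryGroup (Fin n) ℂ =>
      Q f a (unitaryToGL k.1) (unitaryToGL k.2) := by
  obtain ⟨N, T, r, hQ, -, -⟩ := exists_Q_eq hf
  simp only [hQ]
  have hdet (A : GL (Fin n) ℂ) : A.val.det ≠ 0 :=
    ((Matrix.isUnit_iff_isUnit_det _).1 A.isUnit).ne_zero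
  have h1 : Continuous fun k : Matrix.unitaryGroup (Fin n) ℂ × Matrix.unitaryGroup (Fin n) ℂ =>
      (unitaryToGL k.1).val := continuous_subtype_val.comp continuous_fst
  have h2 : Continuous fun k : Matrix.unitaryGroup (Fin n) ℂ × Matrix.unitaryGroup (Fin n) ℂ =>
      ((unitaryToGL k.2)⁻¹).val := by
    simp only [← unitaryToGL_star]
    exact continuous_star.comp (continuous_subtype_val.comp continuous_snd)
  refine ((h1.matrix_det.zpow₀ N fun k => Or.inl (hdet _)).mul
    (h2.matrix_det.zpow₀ N fun k => Or.inl (hdet _))).mul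
    ((MvPolynomial.continuous_eval (r a)).comp (continuous_pi fun s => ?_))
  cases s with
  | inl ij => exact h1.matrix_elem _ _
  | inr ij => exact h2.matrix_elem _ _

/-- The diagonal unitary matrix with angles `θ`. -/
noncomputable def diagUnitary {n : ℕ} (θ : EuclideanSpace ℝ (Fin n)) :
    Matrix.unitaryGroup (Fin n) ℂ :=
  ⟨Matrix.diagonal fun i => Complex.exp (θ i * Complex.I), by
    rw [Matrix.mem_unitaryGroup_iff', Matrix.star_eq_conjTranspose,
      Matrix.diagonal_conjTranspose, Matrix.diagonal_mul_diagonal, ← Matrix.diagonal_one]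
    congr 1
    ext i
    rw [Pi.star_apply, Complex.star_def, ← Complex.normSq_eq_conj_mul_self,
      Complex.normSq_eq_norm_sq, Complex.norm_exp_ofReal_mul_I]
    simp⟩

theorem unitaryToGL_mul_diagUnitary {n : ℕ} (U : Matrix.unitaryGroup (Fin n) ℂ)
    (θ : EuclideanSpace ℝ (Fin n)) :
    unitaryToGL (U * diagUnitary θ) =
      unitaryToGL U * diagGL fun i => Units.mk0 (Complex.exp (θ i * Complex.I))
        (Complex.exp_ne_zero _) :=
  Units.ext rfl

theorem prod_exp_zpow {n : ℕ} (a : Fin n → ℤ) (x : EuclideanSpace ℝ (Fin n)) (c : ℂ) :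
    ∏ i, Complex.exp (x i * c) ^ a i = Complex.exp ((inner ℝ (intPoint a) x : ℝ) * c) := by
  simp_rw [← Complex.exp_int_mul]
  rw [← Complex.exp_sum, inner_intPoint]
  push_cast
  rw [Finset.sum_mul]
  simp_rw [mul_assoc]

/-- The family of Laurent polynomials `z ↦ f (U diag(z) V*)` parametrised by pairs of unitary
matrices; the torus acts by right multiplication of `U` by diagonal matrices. -/
noncomputable def unitaryFamily {n : ℕ} {f : GL (Fin n) ℂ → ℂ} (hf : IsRegularFunction f) :
    LaurentFamily n (Matrix.unitaryGroup (Fin n) ℂ × Matrix.unitaryGroup (Fin n) ℂ) where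
  S := (finite_support hf).toFinset
  q a k := Q f a (unitaryToGL k.1) (unitaryToGL k.2)
  continuous_q := continuous_Q_unitary hf
  exists_q_ne_zero a ha := by
    obtain ⟨U, V, h⟩ := exists_unitary_Q_ne_zero hf ((finite_support hf).mem_toFinset.1 ha)
    exact ⟨(U, V), h⟩
  act θ k := (k.1 * diagUnitary θ, k.2)
  q_act a θ k := by
    rw [unitaryToGL_mul_diagUnitary, Q_mul_diagGL hf]
    simp only [Units.val_mk0]
    rw [prod_exp_zpow]

theorem unitaryFamily_eval {n : ℕ} {f : GL (Fin n) ℂ → ℂ} (hf : IsRegularFunction f)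
    (x : EuclideanSpace ℝ (Fin n)) (U V : Matrix.unitaryGroup (Fin n) ℂ) :
    (unitaryFamily hf).eval x (U, V) =
      f (unitaryToGL U * expDiag x * unitaryToGL (star V)) := by
  rw [unitaryToGL_star, expDiag, apply_mul_diagGL_mul_inv hf]
  refine Finset.sum_congr rfl fun a _ => ?_
  have h := prod_exp_zpow a x 1
  simp only [mul_one] at h
  simp only [Units.val_mk0, h]
  rfl

theorem unitaryFamily_amoebaCompl {n : ℕ} {f : GL (Fin n) ℂ → ℂ} (hf : IsRegularFunction f) :
    (unitaryFamily hf).amoebaCompl = (amoeba f)ᶜ := by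
  ext x
  rw [Set.mem_compl_iff, mem_amoeba_iff]
  simp only [LaurentFamily.amoebaCompl, Set.mem_ofPred_eq, Prod.forall, unitaryFamily_eval]
  push Not
  rfl

theorem ronkin_eq {n : ℕ} {f : GL (Fin n) ℂ → ℂ} (hf : IsRegularFunction f)
    {x : EuclideanSpace ℝ (Fin n)} (hx : x ∈ (unitaryFamily hf).amoebaCompl) :
    ronkin f x = (unitaryFamily hf).ronkin ((haarU n).prod (haarU n)) x := by
  have hcont : Continuous fun k => Real.log ‖(unitaryFamily hf).eval x k‖ := by
    refine Continuous.log ?_ fun k => norm_ne_zero_iff.2 (hx k)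
    exact ((unitaryFamily hf).continuous_eval.comp
      (f := fun k : Matrix.unitaryGroup (Fin n) ℂ × Matrix.unitaryGroup (Fin n) ℂ => (x, k))
      (by fun_prop)).norm
  rw [LaurentFamily.ronkin,
    integral_prod_symm _ (LaurentFamily.integrable_of_continuous _ hcont), ronkin]
  simp only [unitaryFamily_eval]

theorem measurePreserving_act {n : ℕ} {f : GL (Fin n) ℂ → ℂ} (hf : IsRegularFunction f)
    (θ : EuclideanSpace ℝ (Fin n)) :
    MeasurePreserving ((unitaryFamily hf).act θ) ((haarU n).prod (haarU n))
      ((haarU n).prod (haarU n)) :=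
  (measurePreserving_mul_right (haarU n) (diagUnitary θ)).prod (MeasurePreserving.id _)

end MatrixAmoeba

theorem mainTheorem8 (n : ℕ) (f : GL (Fin n) ℂ → ℂ) (hf : MatrixAmoeba.IsRegularFunction f)
    (E : Set (EuclideanSpace ℝ (Fin n))) (hE : MatrixAmoeba.IsComplementComponent f E) :
    -- the order of `E` is well defined, and it is an integer point of `sNewt(f)`
    (∀ x ∈ E, HasGradientAt (MatrixAmoeba.ronkin f) (MatrixAmoeba.order f E) x) ∧
    (∃ m : Fin n → ℤ, MatrixAmoeba.order f E = MatrixAmoeba.intPoint m) ∧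
    MatrixAmoeba.order f E ∈ MatrixAmoeba.sNewt f ∧
    -- there is a smallest face `F` of `sNewt(f)` containing the order of `E`, and `C_F` is the
    -- recession cone of `E`
    (∃ F : Set (EuclideanSpace ℝ (Fin n)),
      IsLeast {G | MatrixAmoeba.IsFace (MatrixAmoeba.sNewt f) G ∧ MatrixAmoeba.order f E ∈ G} F ∧
      MatrixAmoeba.normalCone (MatrixAmoeba.sNewt f) F = MatrixAmoeba.recessionCone E ∧
      (∀ x ∈ E, ∀ w ∈ MatrixAmoeba.normalCone (MatrixAmoeba.sNewt f) F, x + w ∈ E) ∧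
      (∀ C : Set (EuclideanSpace ℝ (Fin n)), MatrixAmoeba.IsCone C →
        MatrixAmoeba.normalCone (MatrixAmoeba.sNewt f) F ⊂ C →
        ∀ x : EuclideanSpace ℝ (Fin n), ¬ (fun w => x + w) '' C ⊆ E)) ∧
    -- the bounded components are those whose order is an interior point of `sNewt(f)`
    (Bornology.IsBounded E ↔
      MatrixAmoeba.order f E ∈ interior (MatrixAmoeba.sNewt f)) := by
  open MatrixAmoeba in
  let L := unitaryFamily hf
  obtain ⟨x₀, hx₀, rfl⟩ := hE
  set E := connectedComponentIn (amoeba f)ᶜ x₀ with hE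
  have hcompl : L.amoebaCompl = (amoeba f)ᶜ := unitaryFamily_amoebaCompl hf
  have hne : E.Nonempty := ⟨x₀, mem_connectedComponentIn hx₀⟩
  have hEc : E ⊆ L.amoebaCompl := hcompl ▸ connectedComponentIn_subset _ _
  have hEo : IsOpen E := by
    have := L.isOpen_amoebaCompl
    rw [hcompl] at this
    exact this.connectedComponentIn
  have hmax : ∀ T ⊆ L.amoebaCompl, IsPreconnected T → (T ∩ E).Nonempty → T ⊆ E := by
    rintro T hT hTc ⟨y, hyT, hyE⟩
    rw [hE, connectedComponentIn_eq hyE]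
    exact hTc.subset_connectedComponentIn hyT (hcompl ▸ hT)
  obtain ⟨m, hgrad, hm⟩ := L.exists_gradient_eq_winding ((haarU n).prod (haarU n))
    (measurePreserving_act hf) isPreconnected_connectedComponentIn hne hEc
  replace hm : L.IsOrder E m := hm
  have hgrad' : ∀ x ∈ E, HasGradientAt (ronkin f) (intPoint m) x := by
    intro x hx
    refine (hgrad x hx).congr_of_eventuallyEq ?_
    filter_upwards [L.isOpen_amoebaCompl.mem_nhds (hEc hx)] with y hy
    exact ronkin_eq hf hy
  have horder : order f E = intPoint m := by
    rw [order, dif_pos hne]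
    exact (hgrad' _ hne.some_mem).gradient
  have hfin := finite_support hf
  have hS : (L.S : Set (Fin n → ℤ)) = support f := hfin.coe_toFinset
  have hmem := hm.mem_convexHull hEc hne
  have hrec := hm.recessionCone_eq hEc hEo hmax hne
  have hbdd := hm.isBounded_iff hEc hEo hmax hne
  have hray {x w : EuclideanSpace ℝ (Fin n)} (h : ∀ t : ℝ, 0 ≤ t → x + t • w ∈ E) :=
    hm.mem_normalCone_of_ray hEc h
  rw [hS] at hmem hrec hbdd hray
  have hsupp : (support f).Nonempty := by
    obtain ⟨_, a, ha, -⟩ := convexHull_nonempty_iff.1 ⟨_, hmem⟩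
    exact ⟨a, ha⟩
  obtain ⟨F, hF, hFN⟩ := exists_isLeast_face hfin hmem
  rw [horder]
  refine ⟨hgrad', ⟨m, rfl⟩, hmem, ⟨F, hF, hFN.trans hrec, fun x hx w hw => ?_,
    fun C hC hFC x hxC => ?_⟩, hbdd.trans (mem_interior_convexHull_iff hfin hsupp).symm⟩
  · have hw' : w ∈ recessionCone E := by
      rw [← hrec, ← hFN]
      exact hw
    simpa using hw' x hx 1 zero_le_one
  · obtain ⟨w, hwC, hwF⟩ := Set.exists_of_ssubset hFC
    refine hwF (hFN.ge (hray (x := x + w) fun t ht => hxC ⟨(1 + t) • w, ?_, ?_⟩))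
    · exact hC w hwC _ (by positivity)
    · simp only [add_smul, one_smul, add_assoc]
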